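/- Consider Bernoulli bond percolation on the square lattice with parameter $1/2$: the vertex set is $\mathbb Z^2$, edges join vertices at distance $1$, and under $\mathbb P_{1/2}$ every edge is independently open with probability $1/2$ and closed otherwise. For integers $m,n\ge 0$ let $\mathcal H(m,n)$ (respectively $\mathcal V(m,n)$) be the event that there is a path of open edges, with all its vertices in the rectangle $[0,m]\times[0,n]$, from the left side $\{0\}\times[0,n]$ to the right side $\{m\}\times[0,n]$ (respectively from the bottom side $[0,m]\times\{0\}$ to the top side $[0,m]\times\{n\}$). **Box-crossing property.** For every real $\rho>0$ there is a constant $c=c(\rho)>0$ such that for every integer $n\ge 1$, $$c\le \mathbb P_{1/2}[\mathcal H(\rho n,n)]\le 1-c,$$ where, if $\rho n$ is not an integer, $\rho n$ may be rounded either up or down to an integer that is at least $1$; that is, $$c\le \mathbb P_{1/2}[\mathcal H(m,n)]\le 1-c\qquad\text{for all integers } m,n\ge 1 \text{ with } |m-\rho n|<1 .$$ Moreover, $\mathbb P_{1/2}[\mathcal V(2n,3n)]\ge \tfrac1{128}$ for every integer $n\ge1$. -/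

import Mathlib

namespace Percolation

/-- The square lattice: the vertex set is `ℤ²` and two vertices are joined by an edge iff they are
at distance `1`. -/
def squareLattice : SimpleGraph (ℤ × ℤ) where
  Adj x y := |x.1 - y.1| + |x.2 - y.2| = 1
  symm := ⟨fun x y h => by rw [abs_sub_comm y.1, abs_sub_comm y.2]; exact h⟩
  loopless := ⟨fun x h => by simp at h⟩

/-- A percolation configuration: every edge of the square lattice is open (`true`) or
closed (`false`). -/
abbrev Config : Type := squareLattice.edgeSet → Bool

/-- Bernoulli bond percolation `ℙ_p` on the square lattice: the edges are open independently,
each with probability `p`. -/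
noncomputable def bondMeasure (p : unitInterval) : MeasureTheory.Measure Config :=
  MeasureTheory.Measure.infinitePi fun _ : squareLattice.edgeSet =>
    ProbabilityTheory.bernoulliMeasure true false p

/-- The parameter `1/2`. -/
noncomputable def half : unitInterval := ⟨1 / 2, by norm_num, by norm_num⟩

/-- The graph on `ℤ²` formed by the open edges of `ω`. -/
def openGraph (ω : Config) : SimpleGraph (ℤ × ℤ) where
  Adj x y := ∃ h : squareLattice.Adj x y, ω ⟨s(x, y), h⟩ = true
  symm := ⟨fun x y ⟨h, hω⟩ => ⟨h.symm, by
    rw [← hω]; exact congrArg ω (Subtype.ext Sym2.eq_swap)⟩⟩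
  loopless := ⟨fun x ⟨h, _⟩ => squareLattice.loopless.irrefl x h⟩

/-- The configuration `ω` contains a path of open edges from a vertex of `A` to a vertex of `B`,
all of whose vertices lie in `R`. -/
def HasOpenPath (ω : Config) (R A B : Set (ℤ × ℤ)) : Prop :=
  ∃ x ∈ A, ∃ y ∈ B, ∃ γ : (openGraph ω).Walk x y, γ.IsPath ∧ ∀ v ∈ γ.support, v ∈ R

/-- The lattice rectangle `R(n, m) = [0, n] × [0, m]`. -/
def rect (n m : ℤ) : Set (ℤ × ℤ) := Set.Icc 0 n ×ˢ Set.Icc 0 m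

/-- The event `𝓗(n, m)` that `R(n, m)` is crossed horizontally: there is an open path in `R(n, m)`
from its left side `{0} × [0, m]` to its right side `{n} × [0, m]`. -/
def horizontalCrossing (n m : ℤ) : Set Config :=
  {ω | HasOpenPath ω (rect n m) ({0} ×ˢ Set.Icc 0 m) ({n} ×ˢ Set.Icc 0 m)}

/-- The event `𝓥(n, m)` that `R(n, m)` is crossed vertically: there is an open path in `R(n, m)`
from its bottom side `[0, n] × {0}` to its top side `[0, n] × {m}`. -/
def verticalCrossing (n m : ℤ) : Set Config :=
  {ω | HasOpenPath ω (rect n m) (Set.Icc 0 n ×ˢ {0}) (Set.Icc 0 n ×ˢ {m})}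

end Percolation

open MeasureTheory

namespace Percolation

/-! Draw the lattice at double scale: points with two even coordinates are vertices and always
black, points with two odd coordinates are faces and always white, and the remaining points are
edges, black when open. No 2 × 2 block is a checkerboard, so nearest-neighbour paths of the two
colours are dual to each other: a rectangle has a black left-right crossing or a white bottom-top
crossing (`hex`), and paths crossing it in the two directions must meet (`crossing_paths_meet`).
Reflection in the line x = y + 1, with the colours exchanged, preserves the law and swaps vertices
with faces. Hence squares are crossed with probability at least 1/2 (`half_le_hcross`), and lower
bounds for crossings turn into upper bounds (`hcross_add_hcross_le`).

The Russo–Seymour–Welsh step passes from squares to longer rectangles. Explore the white cluster of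
the left side of [0, n]². If this square is crossed vertically, the cluster misses the right side,
and its outer boundary contains a black vertical crossing; the colours beyond the explored edges are
still independent of it. That crossing and its mirror image in the line y = n together separate left
from right in [0, 2n]². A horizontal crossing of [0, 2n]², after its last visit to the explored part
and its mirror image, starts from one of the two halves, and by symmetry from the lower one with
probability at least half that of the crossing. So with probability at least 1/2 · 1/2 · 1/2 some
vertical crossing of [0, n]² is joined to the right side of [0, 2n]² (`vcross_mul_hcross_le_arm`).
By Harris, two such arms in opposite directions and a horizontal crossing of their common square
occur together with probability at least 1/8 · 1/8 · 1/2 = 1/128, and they cross a 3n × 2n rectangle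
(`hcross_three_two`). Gluing overlapping rectangles yields every aspect ratio (`exists_le_hcross`).
-/

theorem squareLattice_adj_iff {x y : ℤ × ℤ} : squareLattice.Adj x y ↔
    (y.1 = x.1 + 1 ∧ y.2 = x.2) ∨ (y.1 = x.1 - 1 ∧ y.2 = x.2) ∨
    (y.1 = x.1 ∧ y.2 = x.2 + 1) ∨ (y.1 = x.1 ∧ y.2 = x.2 - 1) := by
  change |x.1 - y.1| + |x.2 - y.2| = 1 ↔ _
  rcases abs_cases (x.1 - y.1) with h | h <;> rcases abs_cases (x.2 - y.2) with h' | h' <;> omega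

/-! ### Connectivity inside subsets of ℤ² -/

/-- The nearest-neighbour graph of `ℤ²`, restricted to the edges inside `S`. -/
def latticeOn (S : Set (ℤ × ℤ)) : SimpleGraph (ℤ × ℤ) where
  Adj u v := squareLattice.Adj u v ∧ u ∈ S ∧ v ∈ S
  symm := ⟨fun _ _ h => ⟨h.1.symm, h.2.2, h.2.1⟩⟩
  loopless := ⟨fun x h => squareLattice.loopless.irrefl x h.1⟩

/-- `p` and `q` are joined by a nearest-neighbour path inside `S`. -/
def Linked (S : Set (ℤ × ℤ)) (p q : ℤ × ℤ) : Prop :=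
  p ∈ S ∧ (latticeOn S).Reachable p q

/-- Some point of `A` is joined to some point of `B` inside `S`. -/
def Joined (S A B : Set (ℤ × ℤ)) : Prop :=
  ∃ p ∈ A, ∃ q ∈ B, Linked S p q

theorem Linked.refl {S : Set (ℤ × ℤ)} {p : ℤ × ℤ} (h : p ∈ S) : Linked S p p :=
  ⟨h, SimpleGraph.Reachable.refl _⟩

theorem Linked.step {S : Set (ℤ × ℤ)} {p q r : ℤ × ℤ} (h : Linked S p q) (hq : q ∈ S)
    (ha : squareLattice.Adj q r) (hr : r ∈ S) : Linked S p r :=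
  ⟨h.1, h.2.trans (SimpleGraph.Adj.reachable (G := latticeOn S) ⟨ha, hq, hr⟩)⟩

theorem Linked.of_adj {S : Set (ℤ × ℤ)} {p q : ℤ × ℤ} (hp : p ∈ S)
    (ha : squareLattice.Adj p q) (hq : q ∈ S) : Linked S p q :=
  (Linked.refl hp).step hp ha hq

theorem Linked.induction {S : Set (ℤ × ℤ)} {p q : ℤ × ℤ} {motive : ℤ × ℤ → Prop}
    (h : Linked S p q) (base : motive p)
    (step : ∀ u v, u ∈ S → v ∈ S → squareLattice.Adj u v → Linked S p u → motive u → motive v) :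
    motive q := by
  have h2 := (SimpleGraph.reachable_iff_reflTransGen _ _).1 h.2
  induction h2 with
  | refl => exact base
  | tail h1 h3 ih =>
    have hl : Linked S p _ := ⟨h.1, (SimpleGraph.reachable_iff_reflTransGen _ _).2 h1⟩
    exact step _ _ h3.2.1 h3.2.2 h3.1 hl (ih hl)

theorem Linked.right_mem {S : Set (ℤ × ℤ)} {p q : ℤ × ℤ} (h : Linked S p q) : q ∈ S :=
  h.induction (motive := (· ∈ S)) h.1 fun _ _ _ hv _ _ _ => hv

theorem Linked.symm {S : Set (ℤ × ℤ)} {p q : ℤ × ℤ} (h : Linked S p q) : Linked S q p :=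
  ⟨h.right_mem, h.2.symm⟩

theorem Linked.trans {S : Set (ℤ × ℤ)} {p q r : ℤ × ℤ} (h : Linked S p q) (h' : Linked S q r) :
    Linked S p r :=
  ⟨h.1, h.2.trans h'.2⟩

theorem Linked.mono {S T : Set (ℤ × ℤ)} (hST : S ⊆ T) {p q : ℤ × ℤ} (h : Linked S p q) :
    Linked T p q :=
  h.induction (Linked.refl (hST h.1)) fun _ _ hu hv ha _ ih => ih.step (hST hu) ha (hST hv)

theorem Joined.mono {S T A B A' B' : Set (ℤ × ℤ)} (h : Joined S A B) (hST : S ⊆ T)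
    (hA : A ⊆ A') (hB : B ⊆ B') : Joined T A' B' := by
  obtain ⟨p, hp, q, hq, h⟩ := h
  exact ⟨p, hA hp, q, hB hq, h.mono hST⟩

/-- A path stays in the set of points linked to its starting point. -/
theorem Linked.in_cluster {S : Set (ℤ × ℤ)} {z p q : ℤ × ℤ} (hz : Linked S z p)
    (h : Linked S p q) : Linked {w | Linked S z w} p q :=
  h.induction (Linked.refl hz) fun _ _ hu hv ha hl ih =>
    ih.step (hz.trans hl) ha ((hz.trans hl).step hu ha hv)

/-! ### Planar topology: crossing paths meet, and the Hex lemma -/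

/-- The counting function of a path that starts to the left of the column `a`. -/
theorem Linked.exists_height {S : Set (ℤ × ℤ)} {p q : ℤ × ℤ} {a c d : ℤ}
    (hS : ∀ z ∈ S, c ≤ z.2 ∧ z.2 ≤ d) (hpa : p.1 ≤ a) (h : Linked S p q) :
    ∃ f : ℤ → ℤ → ℤ, (∀ x y, (x, y) ∉ S → f x (y + 1) = f x y) ∧
      (∀ x y, a ≤ x → (x + 1, y) ∉ S →
        f x y - f (x + 1) y = if q.1 = x + 1 ∧ q.2 < y then 1 else 0) ∧
      (∀ x y, y ≤ c → f x y = 0) ∧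
      (∀ x y, a ≤ x → d < y → f x y = if x < q.1 then 1 else 0) := by
  -- `f x y` is the net number of rightward steps from column x to column x + 1 at heights below y.
  -- The second property is conservation of flow for the part of column x + 1 below y: the path
  -- starts outside that column, and it cannot leave this part vertically because (x + 1, y) is not
  -- in `S`.
  refine h.induction (motive := fun q => ∃ f : ℤ → ℤ → ℤ,
    (∀ x y, (x, y) ∉ S → f x (y + 1) = f x y) ∧
      (∀ x y, a ≤ x → (x + 1, y) ∉ S →
        f x y - f (x + 1) y = if q.1 = x + 1 ∧ q.2 < y then 1 else 0) ∧
      (∀ x y, y ≤ c → f x y = 0) ∧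
      (∀ x y, a ≤ x → d < y → f x y = if x < q.1 then 1 else 0)) ?_ ?_
  · refine ⟨fun _ _ => 0, fun _ _ _ => rfl, fun x y hx _ => ?_, fun _ _ _ => rfl,
      fun x y hx _ => ?_⟩
    · rw [if_neg (by omega)]; rfl
    · rw [if_neg (by omega)]
  · rintro ⟨u1, u2⟩ ⟨v1, v2⟩ hu hv ha - ⟨f, h1, h2, h3, h4⟩
    have hu' := hS _ hu
    have hv' := hS _ hv
    rw [squareLattice_adj_iff] at ha
    simp only at ha hu' hv' h2 h4 ⊢
    have key : ∀ {x y : ℤ}, (x, y) ∉ S → ¬ (x = u1 ∧ y = u2) ∧ ¬ (x = v1 ∧ y = v2) := by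
      intro x y hxy
      constructor
      · rintro ⟨rfl, rfl⟩; exact hxy hu
      · rintro ⟨rfl, rfl⟩; exact hxy hv
    rcases ha with ⟨e1, e2⟩ | ⟨e1, e2⟩ | ⟨e1, e2⟩ | ⟨e1, e2⟩
    · refine ⟨fun x y => f x y + if x = u1 ∧ u2 < y then 1 else 0, ?_, ?_, ?_, ?_⟩
      · intro x y hxy
        have := key hxy
        simp only [h1 x y hxy]
        split_ifs <;> omega
      · intro x y hx hxy
        have := key hxy
        have := h2 x y hx hxy
        simp only
        split_ifs at * <;> omega
      · intro x y hy
        simp only [h3 x y hy]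
        split_ifs <;> omega
      · intro x y hx hy
        simp only [h4 x y hx hy]
        split_ifs <;> omega
    · refine ⟨fun x y => f x y - if x = v1 ∧ u2 < y then 1 else 0, ?_, ?_, ?_, ?_⟩
      · intro x y hxy
        have := key hxy
        simp only [h1 x y hxy]
        split_ifs <;> omega
      · intro x y hx hxy
        have := key hxy
        have := h2 x y hx hxy
        simp only
        split_ifs at * <;> omega
      · intro x y hy
        simp only [h3 x y hy]
        split_ifs <;> omega
      · intro x y hx hy
        simp only [h4 x y hx hy]
        split_ifs <;> omega
    all_goals
      refine ⟨f, h1, ?_, h3, ?_⟩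
      · intro x y hx hxy
        have := key hxy
        rw [h2 x y hx hxy]
        split_ifs <;> omega
      · intro x y hx hy
        rw [h4 x y hx hy]
        split_ifs <;> omega

/-- A path crossing a rectangle from left to right meets every path crossing it from bottom to
top. -/
theorem crossing_paths_meet {S T : Set (ℤ × ℤ)} {a b c d : ℤ}
    (hS : ∀ z ∈ S, c ≤ z.2 ∧ z.2 ≤ d) (hT : ∀ z ∈ T, a ≤ z.1 ∧ z.1 ≤ b)
    (hSj : Joined S {z | z.1 ≤ a} {z | b ≤ z.1}) (hTj : Joined T {z | z.2 ≤ c} {z | d ≤ z.2}) :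
    (S ∩ T).Nonempty := by
  by_contra hne
  rw [Set.not_nonempty_iff_eq_empty] at hne
  obtain ⟨p, hp, q, hq, hpq⟩ := hSj
  obtain ⟨s, hs, t, ht, hst⟩ := hTj
  simp only [Set.mem_ofPred_eq] at hp hq hs ht
  have hqS := hS q hpq.right_mem
  -- The extra step puts the endpoint strictly to the right of column b. It then never contributes
  -- to the flow balance at columns up to b, so the count is constant along the path in `T`, yet it
  -- is 0 at the bottom and 1 at the top.
  have hpq' : Linked (S ∪ {z | b < z.1 ∧ c ≤ z.2 ∧ z.2 ≤ d}) p (q.1 + 1, q.2) :=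
    (hpq.mono Set.subset_union_left).step (Or.inl hpq.right_mem)
      (by rw [squareLattice_adj_iff]; simp) (Or.inr ⟨by simp only; omega, hqS.1, hqS.2⟩)
  obtain ⟨f, h1, h2, h3, h4⟩ := hpq'.exists_height (a := a) (c := c) (d := d)
    (by rintro z (hz | hz); exacts [hS z hz, hz.2]) hp
  have hdis : ∀ z ∈ T, z ∉ S ∪ {z | b < z.1 ∧ c ≤ z.2 ∧ z.2 ≤ d} := by
    rintro z hz (hz' | hz')
    · exact Set.notMem_empty z (hne ▸ ⟨hz', hz⟩)
    · have := hT z hz; have := hz'.1; omega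
  have hconst : f t.1 t.2 = f s.1 s.2 := by
    refine hst.induction (motive := fun z => f z.1 z.2 = f s.1 s.2) rfl ?_
    rintro ⟨u1, u2⟩ ⟨v1, v2⟩ hu hv ha - ih
    rw [squareLattice_adj_iff] at ha
    have hu' := hT _ hu
    have hv' := hT _ hv
    have hu2 := hdis _ hu
    have hv2 := hdis _ hv
    simp only at ha hu' hv' ih ⊢
    rw [← ih]
    rcases ha with ⟨e1, e2⟩ | ⟨e1, e2⟩ | ⟨e1, e2⟩ | ⟨e1, e2⟩
    · subst e1 e2
      have := h2 u1 v2 hu'.1 hv2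
      rw [if_neg (by simp only; omega)] at this
      omega
    · obtain rfl : u1 = v1 + 1 := by omega
      subst e2
      have := h2 v1 v2 hv'.1 hu2
      rw [if_neg (by simp only; omega)] at this
      omega
    · subst e1 e2
      exact h1 _ _ hu2
    · obtain rfl : u2 = v2 + 1 := by omega
      subst e1
      exact (h1 _ _ hv2).symm
  have hs0 := h3 s.1 s.2 hs
  have htT := hT t hst.right_mem
  have htop : f t.1 t.2 = 1 := by
    have h5 := h1 t.1 t.2 (hdis t hst.right_mem)
    rw [← h5, h4 t.1 (t.2 + 1) htT.1 (by omega), if_pos (by simp only; omega)]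
  omega

/-- The increment from `a` to `b` of labels in `{0, 1, 2, 3}` on the cycle `ℤ / 4`. -/
def cyc (a b : ℤ) : ℤ := if b - a = 3 then -1 else if b - a = -3 then 1 else b - a

/-- A discrete winding number argument. Around a unit square the increments lie in {-1, 0, 1} and
add up to a multiple of 4; a nonzero total would need four equal increments, that is alternating
parities, which `hsq` forbids. So the increments around the whole rectangle add up to 0. But each
side avoids one label, so labels lift to integers along it, and the forced lifts make the total 4.
-/
theorem no_cyclic_labelling (M N : ℕ) (L : ℕ → ℕ → ℤ) (hL : ∀ i j, 0 ≤ L i j ∧ L i j ≤ 3)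
    (hh : ∀ i j, i < M → j ≤ N → L (i + 1) j - L i j ≠ 2 ∧ L (i + 1) j - L i j ≠ -2)
    (hv : ∀ i j, i ≤ M → j < N → L i (j + 1) - L i j ≠ 2 ∧ L i (j + 1) - L i j ≠ -2)
    (hsq : ∀ i j, i < M → j < N → ¬ (L i j % 2 = L (i + 1) (j + 1) % 2 ∧
      L (i + 1) j % 2 = L i (j + 1) % 2 ∧ L i j % 2 ≠ L (i + 1) j % 2))
    (hb : ∀ i, i ≤ M → L i 0 ≠ 3) (hr : ∀ j, j ≤ N → L M j ≠ 0)
    (ht : ∀ i, i ≤ M → L i N ≠ 1) (hl : ∀ j, j ≤ N → L 0 j ≠ 2) : False := by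
  have hclosed : ∀ i j, i < M → j < N → cyc (L i j) (L (i + 1) j)
      + cyc (L (i + 1) j) (L (i + 1) (j + 1)) =
      cyc (L i j) (L i (j + 1)) + cyc (L i (j + 1)) (L (i + 1) (j + 1)) := by
    intro i j hi hj
    have a1 := hL i j
    have a2 := hL (i + 1) j
    have a3 := hL i (j + 1)
    have a4 := hL (i + 1) (j + 1)
    have b1 := hh i j hi hj.le
    have b2 := hh i (j + 1) hi hj
    have b3 := hv i j hi.le hj
    have b4 := hv (i + 1) j hi hj
    have b5 := hsq i j hi hj
    generalize L i j = w at *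
    generalize L (i + 1) j = x at *
    generalize L i (j + 1) = y at *
    generalize L (i + 1) (j + 1) = z at *
    unfold cyc
    split_ifs <;> omega
  have hcol : ∀ j, j < N → ∀ i, i ≤ M → cyc (L 0 j) (L 0 (j + 1))
      + ∑ k ∈ Finset.range i, cyc (L k (j + 1)) (L (k + 1) (j + 1)) =
      (∑ k ∈ Finset.range i, cyc (L k j) (L (k + 1) j)) + cyc (L i j) (L i (j + 1)) := by
    intro j hj i
    induction i with
    | zero => intro _; simp
    | succ i ih =>
      intro hi
      have h1 := ih (by omega)
      have h2 := hclosed i j (by omega) hj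
      rw [Finset.sum_range_succ, Finset.sum_range_succ]
      omega
  have htot : ∀ j, j ≤ N → (∑ k ∈ Finset.range j, cyc (L 0 k) (L 0 (k + 1)))
      + ∑ k ∈ Finset.range M, cyc (L k j) (L (k + 1) j) =
      (∑ k ∈ Finset.range M, cyc (L k 0) (L (k + 1) 0))
      + ∑ k ∈ Finset.range j, cyc (L M k) (L M (k + 1)) := by
    intro j
    induction j with
    | zero => intro _; simp
    | succ j ih =>
      intro hj
      have h1 := ih (by omega)
      have h2 := hcol j (by omega) M le_rfl
      rw [Finset.sum_range_succ _ j, Finset.sum_range_succ _ j]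
      omega
  have tele : ∀ (n : ℕ) (g φ : ℕ → ℤ), (∀ k, k < n → cyc (g k) (g (k + 1)) = φ (k + 1) - φ k) →
      ∑ k ∈ Finset.range n, cyc (g k) (g (k + 1)) = φ n - φ 0 := by
    intro n g φ h
    rw [← Finset.sum_range_sub]
    exact Finset.sum_congr rfl fun k hk => h k (Finset.mem_range.1 hk)
  have e1 := tele M (fun k => L k 0) (fun k => L k 0) (by
    intro k hk
    have := hL k 0; have := hL (k + 1) 0; have := hb k hk.le; have := hb (k + 1) hk
    have := hh k 0 hk (Nat.zero_le _)
    unfold cyc; split_ifs <;> omega)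
  have e2 := tele N (fun k => L M k) (fun k => L M k) (by
    intro k hk
    have := hL M k; have := hL M (k + 1); have := hr k hk.le; have := hr (k + 1) hk
    have := hv M k le_rfl hk
    unfold cyc; split_ifs <;> omega)
  -- The top avoids 1 and lifts to {2, 3, 4}; the left side avoids 2 and lifts to {-1, 0, 1}. At
  -- their common corner, labelled 0 or 3, the two lifts differ by 4, while the lifts agree at the
  -- other corners.
  have e3 := tele M (fun k => L k N) (fun k => if L k N = 0 then 4 else L k N) (by
    intro k hk
    have := hL k N; have := hL (k + 1) N; have := ht k hk.le; have := ht (k + 1) hk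
    have := hh k N hk le_rfl
    unfold cyc; split_ifs <;> omega)
  have e4 := tele N (fun k => L 0 k) (fun k => if L 0 k = 3 then -1 else L 0 k) (by
    intro k hk
    have := hL 0 k; have := hL 0 (k + 1); have := hl k hk.le; have := hl (k + 1) hk
    have := hv 0 k (Nat.zero_le _) hk
    unfold cyc; split_ifs <;> omega)
  have e5 := htot N le_rfl
  have c1 := hL 0 0
  have c2 := hL M 0
  have c3 := hL 0 N
  have c4 := hL M N
  have d1 := hb 0 (Nat.zero_le _)
  have d2 := hb M le_rfl
  have d3 := ht 0 (Nat.zero_le _)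
  have d4 := ht M le_rfl
  have d5 := hl 0 (Nat.zero_le _)
  have d6 := hl N le_rfl
  have d7 := hr 0 (Nat.zero_le _)
  have d8 := hr N le_rfl
  split_ifs at e3 e4 <;> omega

/-- The rectangle `[a, b] × [c, d]`. -/
def box (a b c d : ℤ) : Set (ℤ × ℤ) := {z | (a ≤ z.1 ∧ z.1 ≤ b) ∧ c ≤ z.2 ∧ z.2 ≤ d}

open Classical in
/-- Hex lemma: if no `2 × 2` block is coloured like a checkerboard, then a rectangle is
crossed by one colour from left to right or by the other colour from bottom to top. -/
theorem hex {K : Set (ℤ × ℤ)} {a b c d : ℤ} (hab : a ≤ b) (hcd : c ≤ d)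
    (hK : ∀ x y, a ≤ x → x < b → c ≤ y → y < d →
      ¬ (((x, y) ∈ K ↔ (x + 1, y + 1) ∈ K) ∧ ((x + 1, y) ∈ K ↔ (x, y + 1) ∈ K) ∧
        ¬ ((x, y) ∈ K ↔ (x + 1, y) ∈ K))) :
    Joined (K ∩ box a b c d) {z | z.1 = a} {z | z.1 = b} ∨
    Joined (Kᶜ ∩ box a b c d) {z | z.2 = c} {z | z.2 = d} := by
  by_contra hno
  rw [not_or] at hno
  obtain ⟨hn1, hn2⟩ := hno
  obtain ⟨M, hM⟩ := Int.eq_ofNat_of_zero_le (show 0 ≤ b - a by omega)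
  obtain ⟨N, hN⟩ := Int.eq_ofNat_of_zero_le (show 0 ≤ d - c by omega)
  -- Parity records the colour, and the values 0 and 1 mark the clusters of the left and bottom
  -- sides. Neighbours of equal colour share a cluster, so labels differing by 2 are never adjacent;
  -- without crossings the right side avoids 0 and the top avoids 1.
  let l : ℤ × ℤ → ℤ := fun z =>
    if z ∈ K then (if ∃ p, p.1 = a ∧ Linked (K ∩ box a b c d) p z then 0 else 2)
    else (if ∃ p, p.2 = c ∧ Linked (Kᶜ ∩ box a b c d) p z then 1 else 3)
  have hl : ∀ z, 0 ≤ l z ∧ l z ≤ 3 := by intro z; simp only [l]; split_ifs <;> omega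
  have hpar : ∀ z, l z % 2 = if z ∈ K then 0 else 1 := by
    intro z; simp only [l]; split_ifs <;> rfl
  have hadj : ∀ u v, u ∈ box a b c d → v ∈ box a b c d → squareLattice.Adj u v →
      l v - l u ≠ 2 := by
    intro u v hu hv ha
    simp only [l]
    by_cases h1 : v ∈ K <;> by_cases h2 : u ∈ K <;> simp only [h1, h2, if_true, if_false]
    · by_cases h3 : ∃ p, p.1 = a ∧ Linked (K ∩ box a b c d) p u
      · obtain ⟨p, hp, hpl⟩ := h3
        rw [if_pos ⟨p, hp, hpl.step hpl.right_mem ha ⟨h1, hv⟩⟩]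
        split_ifs <;> omega
      · rw [if_neg h3]
        split_ifs <;> omega
    · split_ifs <;> omega
    · split_ifs <;> omega
    · by_cases h3 : ∃ p, p.2 = c ∧ Linked (Kᶜ ∩ box a b c d) p u
      · obtain ⟨p, hp, hpl⟩ := h3
        rw [if_pos ⟨p, hp, hpl.step hpl.right_mem ha ⟨h1, hv⟩⟩]
        split_ifs <;> omega
      · rw [if_neg h3]
        split_ifs <;> omega
  have hadj' : ∀ u v, u ∈ box a b c d → v ∈ box a b c d → squareLattice.Adj u v →
      l v - l u ≠ 2 ∧ l v - l u ≠ -2 := by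
    intro u v hu hv ha
    have h1 := hadj u v hu hv ha
    have h2 := hadj v u hv hu ha.symm
    omega
  have hmem : ∀ i j : ℕ, i ≤ M → j ≤ N → ((a + i, c + j) : ℤ × ℤ) ∈ box a b c d := by
    intro i j hi hj
    simp only [box, Set.mem_ofPred_eq]
    omega
  refine no_cyclic_labelling M N (fun i j => l (a + i, c + j)) (fun i j => hl _) ?_ ?_ ?_ ?_ ?_ ?_ ?_
  · intro i j hi hj
    exact hadj' _ _ (hmem i j hi.le hj) (hmem (i + 1) j hi hj)
      (by rw [squareLattice_adj_iff]; push_cast; omega)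
  · intro i j hi hj
    exact hadj' _ _ (hmem i j hi hj.le) (hmem i (j + 1) hi hj)
      (by rw [squareLattice_adj_iff]; push_cast; omega)
  · intro i j hi hj
    have := hK (a + i) (c + j) (by omega) (by omega) (by omega) (by omega)
    simp only [hpar, Nat.cast_add, Nat.cast_one, ← add_assoc]
    revert this
    by_cases h1 : (a + (i : ℤ), c + (j : ℤ)) ∈ K <;>
    by_cases h2 : (a + (i : ℤ) + 1, c + (j : ℤ)) ∈ K <;>
    by_cases h3 : (a + (i : ℤ), c + (j : ℤ) + 1) ∈ K <;>
    by_cases h4 : (a + (i : ℤ) + 1, c + (j : ℤ) + 1) ∈ K <;> simp [h1, h2, h3, h4]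
  · intro i hi
    have hm := hmem i 0 hi (Nat.zero_le _)
    simp only [l]
    split_ifs with h1 h2 h3 <;> try omega
    exact absurd ⟨_, by simp, Linked.refl ⟨h1, hm⟩⟩ h3
  · intro j hj
    have hm := hmem M j le_rfl hj
    simp only [l]
    split_ifs with h1 h2 h3 <;> try omega
    obtain ⟨p, hp, hpl⟩ := h2
    exact absurd ⟨p, hp, _, by simp only [Set.mem_ofPred_eq]; omega, hpl⟩ hn1
  · intro i hi
    have hm := hmem i N hi le_rfl
    simp only [l]
    split_ifs with h1 h2 h3 <;> try omega
    obtain ⟨p, hp, hpl⟩ := h3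
    exact absurd ⟨p, hp, _, by simp only [Set.mem_ofPred_eq]; omega, hpl⟩ hn2
  · intro j hj
    have hm := hmem 0 j (Nat.zero_le _) hj
    simp only [l]
    split_ifs with h1 h2 h3 <;> try omega
    exact absurd ⟨_, by simp, Linked.refl ⟨h1, hm⟩⟩ h2

/-! ### Fair colourings: symmetries, Harris inequality, independence -/

/-- Independent fair colours on all points of `ℤ²`. -/
noncomputable def cellMeasure : Measure (ℤ × ℤ → Bool) :=
  Measure.infinitePi fun _ => ProbabilityTheory.bernoulliMeasure true false half

instance : IsProbabilityMeasure cellMeasure := by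
  unfold cellMeasure; infer_instance

theorem half_singleton (b : Bool) :
    (ProbabilityTheory.bernoulliMeasure true false half) {b} = 2⁻¹ := by
  have h : (ProbabilityTheory.bernoulliMeasure true false half).real {b} = 2⁻¹ := by
    rw [ProbabilityTheory.bernoulliMeasure_real_apply _ (measurableSet_singleton b)]
    cases b <;> norm_num [half, unitInterval.symm]
  rw [← ENNReal.toReal_eq_toReal_iff' (measure_ne_top _ _) (by simp)]
  simpa [Measure.real] using h

theorem map_comp_cellMeasure {f : ℤ × ℤ → ℤ × ℤ} (hf : Function.Injective f) :
    cellMeasure.map (fun ξ k => ξ (f k)) = cellMeasure :=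
  Measure.map_infinitePi_infinitePi_of_inj hf

theorem map_not_cellMeasure : cellMeasure.map (fun ξ k => !ξ k) = cellMeasure := by
  have h := Measure.infinitePi_map_pi
    (μ := fun _ : ℤ × ℤ => ProbabilityTheory.bernoulliMeasure true false half)
    (f := fun _ b => !b) (fun _ => measurable_of_countable _)
  have h2 : (ProbabilityTheory.bernoulliMeasure true false half).map (fun b => !b) =
      ProbabilityTheory.bernoulliMeasure true false half := by
    refine Measure.ext_of_singleton fun b => ?_
    rw [Measure.map_apply (measurable_of_countable _) (measurableSet_singleton b)]
    have : (fun b : Bool => !b) ⁻¹' {b} = {!b} := by ext c; cases b <;> cases c <;> simp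
    rw [this, half_singleton, half_singleton]
  rw [cellMeasure]
  simpa only [h2] using h

/-- The event `A` depends only on the colours of the points of `s`. -/
def DeterminedBy (A : Set (ℤ × ℤ → Bool)) (s : Set (ℤ × ℤ)) : Prop :=
  ∀ ξ ξ' : ℤ × ℤ → Bool, (∀ p ∈ s, ξ p = ξ' p) → ξ ∈ A → ξ' ∈ A

theorem DeterminedBy.mono {A : Set (ℤ × ℤ → Bool)} {s t : Set (ℤ × ℤ)} (h : DeterminedBy A s)
    (hst : s ⊆ t) : DeterminedBy A t :=
  fun ξ ξ' hξ => h ξ ξ' fun p hp => hξ p (hst hp)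

theorem DeterminedBy.inter {A B : Set (ℤ × ℤ → Bool)} {s : Set (ℤ × ℤ)} (h : DeterminedBy A s)
    (h' : DeterminedBy B s) : DeterminedBy (A ∩ B) s :=
  fun ξ ξ' hξ hm => ⟨h ξ ξ' hξ hm.1, h' ξ ξ' hξ hm.2⟩

open Classical in
/-- The extension by `false` of a colouring of `s`. -/
noncomputable def extendCells (s : Finset (ℤ × ℤ)) (η : s → Bool) : ℤ × ℤ → Bool :=
  fun p => if h : p ∈ s then η ⟨p, h⟩ else false

theorem DeterminedBy.eq_preimage {A : Set (ℤ × ℤ → Bool)} {s : Finset (ℤ × ℤ)}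
    (h : DeterminedBy A s) : A = s.restrict ⁻¹' {η | extendCells s η ∈ A} := by
  have key : ∀ ξ : ℤ × ℤ → Bool, ∀ p ∈ (s : Set (ℤ × ℤ)),
      ξ p = extendCells s (s.restrict ξ) p := by
    intro ξ p hp
    simp [extendCells, Finset.mem_coe.1 hp]
  ext ξ
  exact ⟨fun hξ => h _ _ (key ξ) hξ, fun hξ => h _ _ (fun p hp => (key ξ p hp).symm) hξ⟩

theorem DeterminedBy.measurableSet {A : Set (ℤ × ℤ → Bool)} {s : Set (ℤ × ℤ)}
    (h : DeterminedBy A s) (hs : s.Finite) : MeasurableSet A := by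
  lift s to Finset (ℤ × ℤ) using hs
  rw [h.eq_preimage]
  exact (Finset.measurable_restrict s) (Set.toFinite _).measurableSet

-- Every colouring of a finite set has the same weight, so the probability is a normalised count.
-- This is the form in which the FKG inequality on a finite cube applies.
open Classical in
theorem DeterminedBy.measure_eq {A : Set (ℤ × ℤ → Bool)} {s : Finset (ℤ × ℤ)}
    (h : DeterminedBy A s) : cellMeasure.real A =
      ∑ η : s → Bool, (2⁻¹ : ℝ) ^ s.card * if extendCells s η ∈ A then 1 else 0 := by
  have h1 : cellMeasure.real A =
      (Measure.pi fun _ : s => ProbabilityTheory.bernoulliMeasure true false half).real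
        {η | extendCells s η ∈ A} := by
    conv_lhs => rw [h.eq_preimage]
    rw [Measure.real, Measure.real, ← Measure.map_apply (Finset.measurable_restrict s)
      (Set.toFinite _).measurableSet, cellMeasure, Measure.infinitePi_map_restrict]
  have h2 : ({η | extendCells s η ∈ A} : Set (s → Bool)) =
      ((Finset.univ.filter fun η => extendCells s η ∈ A : Finset (s → Bool)) : Set _) := by
    ext η; simp
  rw [h1, h2, ← sum_measureReal_singleton, Finset.sum_filter]
  refine Finset.sum_congr rfl fun η _ => ?_
  rw [Measure.real, Measure.pi_singleton]
  simp only [half_singleton]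
  split_ifs <;> simp

/-- **Harris inequality** for increasing events depending on finitely many colours. -/
theorem harris {A B : Set (ℤ × ℤ → Bool)} {s : Set (ℤ × ℤ)} (hs : s.Finite)
    (hA : DeterminedBy A s) (hB : DeterminedBy B s) (hA' : IsUpperSet A) (hB' : IsUpperSet B) :
    cellMeasure.real A * cellMeasure.real B ≤ cellMeasure.real (A ∩ B) := by
  classical
  lift s to Finset (ℤ × ℤ) using hs
  have hmono : ∀ C : Set (ℤ × ℤ → Bool), IsUpperSet C →
      Monotone fun η : s → Bool => if extendCells s η ∈ C then (1 : ℝ) else 0 := by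
    intro C hC η η' hη
    have : extendCells s η ≤ extendCells s η' := by
      intro p
      unfold extendCells
      split_ifs
      exacts [hη _, le_rfl]
    simp only
    split_ifs with h1 h2
    exacts [le_rfl, absurd (hC this h1) h2, zero_le_one, le_rfl]
  have hnn : ∀ C : Set (ℤ × ℤ → Bool),
      (0 : (s → Bool) → ℝ) ≤ fun η => if extendCells s η ∈ C then (1 : ℝ) else 0 := by
    intro C η; simp only [Pi.zero_apply]; split_ifs <;> norm_num
  have hpos : (0 : (s → Bool) → ℝ) ≤ fun _ => (2⁻¹ : ℝ) ^ s.card := fun _ => by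
    rw [Pi.zero_apply]; positivity
  -- The weight is constant, so the lattice condition of FKG holds with equality.
  have := fkg _ _ (fun _ : s → Bool => (2⁻¹ : ℝ) ^ s.card) hpos (hnn A) (hnn B) (hmono A hA') (hmono B hB') (fun _ _ => le_rfl)
  rw [hA.measure_eq, hB.measure_eq, (hA.inter hB).measure_eq]
  refine this.trans (le_of_eq ?_)
  have huniv : (∑ _η : s → Bool, (2⁻¹ : ℝ) ^ s.card) = 1 := by
    simp
  rw [huniv, one_mul]
  refine Finset.sum_congr rfl fun η _ => ?_
  congr 1
  by_cases h1 : extendCells s η ∈ A <;> by_cases h2 : extendCells s η ∈ B <;> simp [h1, h2]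

theorem DeterminedBy.indep {A B : Set (ℤ × ℤ → Bool)} {s t : Set (ℤ × ℤ)} (hs : s.Finite)
    (ht : t.Finite) (hA : DeterminedBy A s) (hB : DeterminedBy B t) (hst : Disjoint s t) :
    cellMeasure.real (A ∩ B) = cellMeasure.real A * cellMeasure.real B := by
  lift s to Finset (ℤ × ℤ) using hs
  lift t to Finset (ℤ × ℤ) using ht
  have hi : ProbabilityTheory.iIndepFun (fun (p : ℤ × ℤ) (ξ : ℤ × ℤ → Bool) => ξ p)
      cellMeasure := ProbabilityTheory.iIndepFun_infinitePi
        (X := fun _ b => b) (fun _ => measurable_id)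
  have := hi.indepFun_finset s t (Finset.disjoint_coe.1 hst) (fun p => measurable_pi_apply p)
  have := this.measure_inter_preimage_eq_mul {η | extendCells s η ∈ A} {η | extendCells t η ∈ B}
    (Set.toFinite _).measurableSet (Set.toFinite _).measurableSet
  rw [Measure.real, Measure.real, Measure.real, ← ENNReal.toReal_mul, hA.eq_preimage,
    hB.eq_preimage]
  exact congrArg ENNReal.toReal this

/-! ### The doubled lattice and its crossing events -/

/-- The black cells of the doubled lattice: the points with even coordinates stand for the
vertices of the square lattice, the points with odd coordinates for its faces and the other
points, coloured by `ξ`, for its edges. -/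
def black (ξ : ℤ × ℤ → Bool) : Set (ℤ × ℤ) :=
  {p | (p.1 % 2 = 0 ∧ p.2 % 2 = 0) ∨ ((p.1 + p.2) % 2 = 1 ∧ ξ p = true)}

theorem mem_black {ξ : ℤ × ℤ → Bool} {p : ℤ × ℤ} :
    p ∈ black ξ ↔ (p.1 % 2 = 0 ∧ p.2 % 2 = 0) ∨ ((p.1 + p.2) % 2 = 1 ∧ ξ p = true) := Iff.rfl

theorem mem_black_of_even {ξ : ℤ × ℤ → Bool} {p : ℤ × ℤ} (h : p.1 % 2 = 0) (h' : p.2 % 2 = 0) :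
    p ∈ black ξ := Or.inl ⟨h, h'⟩

theorem notMem_black_of_odd {ξ : ℤ × ℤ → Bool} {p : ℤ × ℤ} (h : p.1 % 2 = 1)
    (h' : p.2 % 2 = 1) : p ∉ black ξ := by
  rw [mem_black]; omega

theorem mem_black_of_mixed {ξ : ℤ × ℤ → Bool} {p : ℤ × ℤ} (h : (p.1 + p.2) % 2 = 1) :
    p ∈ black ξ ↔ ξ p = true := by
  rw [mem_black]
  exact ⟨fun h' => h'.elim (fun _ => by omega) (·.2), fun h' => Or.inr ⟨h, h'⟩⟩

theorem black_congr {ξ ξ' : ℤ × ℤ → Bool} {p : ℤ × ℤ} (h : ξ p = ξ' p) :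
    p ∈ black ξ ↔ p ∈ black ξ' := by
  rw [mem_black, mem_black, h]

theorem black_mono {ξ ξ' : ℤ × ℤ → Bool} (h : ξ ≤ ξ') : black ξ ⊆ black ξ' := by
  rintro p (hp | ⟨hp, hξ⟩)
  exacts [Or.inl hp, Or.inr ⟨hp, h p hξ⟩]

/-- Each block has a vertex and a face at opposite corners, so one of its diagonals carries two
colours. -/
theorem black_not_checkerboard (ξ : ℤ × ℤ → Bool) (x y : ℤ) :
    ¬ (((x, y) ∈ black ξ ↔ (x + 1, y + 1) ∈ black ξ) ∧
      ((x + 1, y) ∈ black ξ ↔ (x, y + 1) ∈ black ξ) ∧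
        ¬ ((x, y) ∈ black ξ ↔ (x + 1, y) ∈ black ξ)) := by
  rintro ⟨h1, h2, -⟩
  rcases Int.emod_two_eq_zero_or_one x with hx | hx <;>
  rcases Int.emod_two_eq_zero_or_one y with hy | hy
  · exact notMem_black_of_odd (by simp only; omega) (by simp only; omega)
      (h1.1 (mem_black_of_even hx hy))
  · exact notMem_black_of_odd (by simp only; omega) (by simp only; omega)
      (h2.2 (mem_black_of_even (by simp only; omega) (by simp only; omega)))
  · exact notMem_black_of_odd (by simp only; omega) (by simp only; omega)
      (h2.1 (mem_black_of_even (by simp only; omega) (by simp only; omega)))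
  · exact notMem_black_of_odd (by simp only; omega) (by simp only; omega)
      (h1.2 (mem_black_of_even (by simp only; omega) (by simp only; omega)))

theorem black_inter_congr {ξ ξ' : ℤ × ℤ → Bool} {R : Set (ℤ × ℤ)} (h : ∀ p ∈ R, ξ p = ξ' p) :
    black ξ ∩ R = black ξ' ∩ R := by
  ext p
  exact and_congr_left fun hp => black_congr (h p hp)

theorem finite_box (a b c d : ℤ) : (box a b c d).Finite :=
  ((Set.finite_Icc a b).prod (Set.finite_Icc c d)).subset fun _ hz => ⟨hz.1, hz.2⟩

theorem Linked.map {S T : Set (ℤ × ℤ)} {p q : ℤ × ℤ} (h : Linked S p q) (f : ℤ × ℤ → ℤ × ℤ)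
    (hf : ∀ u v, squareLattice.Adj u v → squareLattice.Adj (f u) (f v))
    (hST : ∀ u ∈ S, f u ∈ T) : Linked T (f p) (f q) :=
  h.induction (motive := fun q => Linked T (f p) (f q)) (Linked.refl (hST _ h.1))
    fun _ _ hu hv ha _ ih => ih.step (hST _ hu) (hf _ _ ha) (hST _ hv)

theorem Linked.exists_adj {S : Set (ℤ × ℤ)} {p q : ℤ × ℤ} (h : Linked S p q) (hpq : p ≠ q) :
    ∃ r ∈ S, squareLattice.Adj p r := by
  refine (h.induction (motive := fun q => p = q ∨ ∃ r ∈ S, squareLattice.Adj p r)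
    (Or.inl rfl) ?_).resolve_left hpq
  rintro u v - hv ha - (rfl | ih)
  exacts [Or.inr ⟨v, hv, ha⟩, Or.inr ih]

/-- The part of a path after its last visit to `T`. -/
theorem Linked.last_exit {S T : Set (ℤ × ℤ)} {p q : ℤ × ℤ} (h : Linked S p q) (hp : p ∈ T) :
    ∃ v ∈ T, v ∈ S ∧ Linked (S \ T ∪ {v}) v q := by
  refine h.induction (motive := fun q => ∃ v ∈ T, v ∈ S ∧ Linked (S \ T ∪ {v}) v q)
    ⟨p, hp, h.1, Linked.refl (Or.inr rfl)⟩ ?_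
  rintro u w hu hw ha - ⟨v, hvT, hvS, hl⟩
  by_cases hwT : w ∈ T
  · exact ⟨w, hwT, hw, Linked.refl (Or.inr rfl)⟩
  · exact ⟨v, hvT, hvS, hl.step hl.right_mem ha (Or.inl ⟨hw, hwT⟩)⟩

/-- The part of a path before its first visit to the column `b`. -/
theorem Linked.first_hit {S : Set (ℤ × ℤ)} {p q : ℤ × ℤ} {b : ℤ} (h : Linked S p q)
    (hp : p.1 ≤ b) (hq : b ≤ q.1) : ∃ r, r.1 = b ∧ Linked (S ∩ {z | z.1 ≤ b}) p r := by
  have key : (q.1 ≤ b ∧ Linked (S ∩ {z | z.1 ≤ b}) p q) ∨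
      ∃ r, r.1 = b ∧ Linked (S ∩ {z | z.1 ≤ b}) p r := by
    refine h.induction (motive := fun q => (q.1 ≤ b ∧ Linked (S ∩ {z | z.1 ≤ b}) p q) ∨
      ∃ r, r.1 = b ∧ Linked (S ∩ {z | z.1 ≤ b}) p r) (Or.inl ⟨hp, Linked.refl ⟨h.1, hp⟩⟩) ?_
    rintro u v hu hv ha - (⟨hub, hl⟩ | h)
    · by_cases hvb : v.1 ≤ b
      · exact Or.inl ⟨hvb, hl.step hl.right_mem ha ⟨hv, hvb⟩⟩
      · rw [squareLattice_adj_iff] at ha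
        exact Or.inr ⟨u, by omega, hl⟩
    · exact Or.inr h
  rcases key with ⟨hqb, hl⟩ | h
  exacts [⟨q, by omega, hl⟩, h]

/-- There is a black path inside `R` from `A` to `B`. -/
def crossing (R A B : Set (ℤ × ℤ)) : Set (ℤ × ℤ → Bool) := {ξ | Joined (black ξ ∩ R) A B}

theorem determinedBy_of_black {A : Set (ℤ × ℤ → Bool)} {R : Set (ℤ × ℤ)}
    (h : ∀ ξ ξ' : ℤ × ℤ → Bool, black ξ ∩ R = black ξ' ∩ R → ξ ∈ A → ξ' ∈ A) :
    DeterminedBy A R :=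
  fun ξ ξ' hξ => h ξ ξ' (black_inter_congr hξ)

theorem determinedBy_crossing (R A B : Set (ℤ × ℤ)) : DeterminedBy (crossing R A B) R :=
  determinedBy_of_black fun ξ ξ' h hξ => by
    change Joined _ _ _
    rw [← h]
    exact hξ

theorem isUpperSet_crossing (R A B : Set (ℤ × ℤ)) : IsUpperSet (crossing R A B) :=
  fun _ _ h hξ => Joined.mono hξ (Set.inter_subset_inter_left _ (black_mono h)) subset_rfl
    subset_rfl

theorem crossing_mono {R A B R' A' B' : Set (ℤ × ℤ)} (hR : R ⊆ R') (hA : A ⊆ A') (hB : B ⊆ B') :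
    crossing R A B ⊆ crossing R' A' B' :=
  fun _ h => Joined.mono h (Set.inter_subset_inter_right _ hR) hA hB

/-- Invariance of `cellMeasure` under injective reindexing. -/
theorem measure_le_of_comp {E E' : Set (ℤ × ℤ → Bool)} {R : Set (ℤ × ℤ)} (hR : R.Finite)
    (hE : DeterminedBy E R) {f : ℤ × ℤ → ℤ × ℤ} (hf : Function.Injective f)
    (h : ∀ ξ : ℤ × ℤ → Bool, (fun k => ξ (f k)) ∈ E → ξ ∈ E') :
    cellMeasure.real E ≤ cellMeasure.real E' := by
  have : cellMeasure.real E = cellMeasure.real ((fun ξ k => ξ (f k)) ⁻¹' E) := by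
    rw [Measure.real, Measure.real, ← Measure.map_apply (by fun_prop) (hE.measurableSet hR),
      map_comp_cellMeasure hf]
  rw [this]
  exact measureReal_mono h

/-- Invariance of `cellMeasure` under injective reindexing and exchange of the colours. -/
theorem measure_le_of_comp_not {E E' : Set (ℤ × ℤ → Bool)} {R : Set (ℤ × ℤ)} (hR : R.Finite)
    (hE : DeterminedBy E R) {f : ℤ × ℤ → ℤ × ℤ} (hf : Function.Injective f)
    (h : ∀ ξ : ℤ × ℤ → Bool, (fun k => !ξ (f k)) ∈ E → ξ ∈ E') :
    cellMeasure.real E ≤ cellMeasure.real E' := by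
  have : cellMeasure.real E = cellMeasure.real ((fun ξ k => !ξ k) ⁻¹' E) := by
    have hm : Measurable fun (ξ : ℤ × ℤ → Bool) k => !ξ k :=
      measurable_pi_lambda _ fun i =>
        (measurable_of_countable fun b : Bool => !b).comp (measurable_pi_apply i)
    rw [Measure.real, Measure.real, ← Measure.map_apply hm (hE.measurableSet hR),
      map_not_cellMeasure]
  have hE' : DeterminedBy ((fun (ξ : ℤ × ℤ → Bool) k => !ξ k) ⁻¹' E) R :=
    fun ξ ξ' hξ hm => hE _ _ (fun p hp => by simp only [hξ p hp]) hm
  rw [this]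
  exact measure_le_of_comp hR hE' hf h

/-! ### Duality -/

/-- The event that `[0, m] × [0, n]` is crossed horizontally. -/
def hcross (m n : ℤ) : Set (ℤ × ℤ → Bool) :=
  crossing (box 0 (2 * m) 0 (2 * n)) {z | z.1 = 0} {z | z.1 = 2 * m}

/-- The event that `[0, m] × [0, n]` is crossed vertically. -/
def vcross (m n : ℤ) : Set (ℤ × ℤ → Bool) :=
  crossing (box 0 (2 * m) 0 (2 * n)) {z | z.2 = 0} {z | z.2 = 2 * n}

theorem hcross_le_vcross (m n : ℤ) :
    cellMeasure.real (hcross m n) ≤ cellMeasure.real (vcross n m) := by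
  refine measure_le_of_comp (finite_box _ _ _ _) (determinedBy_crossing _ _ _)
    (f := Prod.swap) Prod.swap_injective ?_
  rintro ξ ⟨p, hp, q, hq, h⟩
  refine ⟨p.swap, hp, q.swap, hq, h.map Prod.swap ?_ ?_⟩
  · intro u v ha
    rw [squareLattice_adj_iff] at ha ⊢
    simp only [Prod.fst_swap, Prod.snd_swap]
    omega
  · rintro ⟨x, y⟩ ⟨hb, hbox⟩
    refine ⟨?_, hbox.2, hbox.1⟩
    rw [mem_black] at hb ⊢
    exact hb.imp (fun h => ⟨h.2, h.1⟩) fun h => ⟨by rw [← h.1]; exact congrArg (· % 2) (add_comm _ _), h.2⟩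

/-- The map involved is the reflection in the line x = y + 1. It exchanges vertices with faces and
preserves the set of edge cells, so with the edge colours flipped it exchanges black and white. -/
theorem mem_black_of_dual {ξ : ℤ × ℤ → Bool} {z : ℤ × ℤ}
    (h : z ∉ black fun k => !ξ (k.2 + 1, k.1 - 1)) : (z.2 + 1, z.1 - 1) ∈ black ξ := by
  rw [mem_black] at h ⊢
  simp only [Bool.not_eq_true'] at h
  rcases Int.emod_two_eq_zero_or_one z.1 with h1 | h1 <;>
  rcases Int.emod_two_eq_zero_or_one z.2 with h2 | h2
  · exact absurd (Or.inl ⟨h1, h2⟩) h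
  · refine Or.inr ⟨by omega, ?_⟩
    rw [← Bool.not_eq_false]
    exact fun h' => h (Or.inr ⟨by omega, h'⟩)
  · refine Or.inr ⟨by omega, ?_⟩
    rw [← Bool.not_eq_false]
    exact fun h' => h (Or.inr ⟨by omega, h'⟩)
  · exact Or.inl ⟨by omega, by omega⟩

theorem notMem_black_of_dual {ξ : ℤ × ℤ → Bool} {z : ℤ × ℤ}
    (h : z ∈ black fun k => !ξ (k.2 + 1, k.1 - 1)) : (z.2 + 1, z.1 - 1) ∉ black ξ := by
  rw [mem_black] at h ⊢
  simp only [Bool.not_eq_true'] at h ⊢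
  rintro (h' | ⟨h', h2⟩)
  · omega
  · rcases h with h | ⟨-, h⟩
    · omega
    · rw [h] at h2; exact Bool.false_ne_true h2

theorem dual_injective : Function.Injective fun k : ℤ × ℤ => (k.2 + 1, k.1 - 1) := by
  rintro ⟨a, b⟩ ⟨c, d⟩ h
  simp only [Prod.mk.injEq] at h ⊢
  omega

theorem dual_adj (u v : ℤ × ℤ) (ha : squareLattice.Adj u v) :
    squareLattice.Adj (u.2 + 1, u.1 - 1) (v.2 + 1, v.1 - 1) := by
  rw [squareLattice_adj_iff] at ha ⊢
  simp only
  omega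

/-- Self-duality: squares are crossed with probability at least `1/2`. -/
theorem half_le_hcross {n : ℤ} (hn : 1 ≤ n) : 1 / 2 ≤ cellMeasure.real (hcross n n) := by
  -- The box is invariant under the duality reflection, which carries its bottom and top sides to
  -- its left and right sides. By `hex` one of the two crossings always exists.
  set E : Set (ℤ × ℤ → Bool) :=
    crossing (box 1 (2 * n) 0 (2 * n - 1)) {z | z.1 = 1} {z | z.1 = 2 * n} with hE
  set E' : Set (ℤ × ℤ → Bool) := {ξ | Joined ((black ξ)ᶜ ∩ box 1 (2 * n) 0 (2 * n - 1))
    {z | z.2 = 0} {z | z.2 = 2 * n - 1}} with hE'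
  have hun : cellMeasure.real (E ∪ E') = 1 := by
    have : E ∪ E' = Set.univ := Set.eq_univ_of_forall fun ξ =>
      hex (by omega) (by omega) fun x y _ _ _ _ => black_not_checkerboard ξ x y
    rw [this, probReal_univ]
  have hdet : DeterminedBy E' (box 1 (2 * n) 0 (2 * n - 1)) := by
    intro ξ ξ' hξ hm
    change Joined _ _ _ at hm ⊢
    have : (black ξ')ᶜ ∩ box 1 (2 * n) 0 (2 * n - 1) =
        (black ξ)ᶜ ∩ box 1 (2 * n) 0 (2 * n - 1) := by
      ext p
      exact and_congr_left fun hp => not_congr (black_congr (hξ p hp)).symm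
    rwa [this]
  have hle : cellMeasure.real E' ≤ cellMeasure.real E := by
    refine measure_le_of_comp_not (finite_box _ _ _ _) hdet dual_injective ?_
    rintro ξ ⟨p, hp, q, hq, h⟩
    simp only [Set.mem_ofPred_eq] at hp hq
    refine ⟨(p.2 + 1, p.1 - 1), by simp [hp], (q.2 + 1, q.1 - 1), by simp [hq],
      h.map _ dual_adj ?_⟩
    rintro z ⟨hz, hzb⟩
    refine ⟨mem_black_of_dual hz, ?_⟩
    simp only [box, Set.mem_ofPred_eq] at hzb ⊢
    omega
  have hEH : E ⊆ hcross n n := by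
    rintro ξ ⟨p, hp, q, hq, h⟩
    have hpm := h.1
    simp only [Set.mem_ofPred_eq, box, Set.mem_inter_iff] at hp hq hpm
    -- A black cell in column 1 is a horizontal edge, so the crossing extends to the left endpoint
    -- of that edge in column 0.
    have hp2 : p.2 % 2 = 0 := by
      by_contra hne
      exact notMem_black_of_odd (by rw [hp]; rfl) (by omega) hpm.1
    have h' := h.mono (T := black ξ ∩ box 0 (2 * n) 0 (2 * n)) (by
      rintro z ⟨hz, hzb⟩
      refine ⟨hz, ?_⟩
      simp only [box, Set.mem_ofPred_eq] at hzb ⊢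
      omega)
    refine ⟨(0, p.2), rfl, q, hq, (Linked.of_adj ?_ ?_ h'.1).trans h'⟩
    · refine ⟨mem_black_of_even rfl hp2, ?_⟩
      simp only [box, Set.mem_ofPred_eq]
      omega
    · exact squareLattice_adj_iff.2 (Or.inl ⟨by simpa using hp, rfl⟩)
  have h1 := measureReal_union_le (μ := cellMeasure) E E'
  have h2 : cellMeasure.real E ≤ cellMeasure.real (hcross n n) := measureReal_mono hEH
  linarith

/-- A horizontal black crossing excludes a vertical white crossing. -/
theorem hcross_add_hcross_le {m n : ℤ} :
    cellMeasure.real (hcross m n) + cellMeasure.real (hcross (n + 1) (m - 1)) ≤ 1 := by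
  -- The dual rectangle: the reflection of the doubled rectangle [0, 2(n + 1)] × [0, 2(m - 1)]. It
  -- is one cell narrower on each side than the box of `hcross m n` and one cell taller at each end.
  set F : Set (ℤ × ℤ → Bool) := {ξ | Joined ((black ξ)ᶜ ∩ box 1 (2 * m - 1) (-1) (2 * n + 1))
    {z | z.2 = -1} {z | z.2 = 2 * n + 1}} with hF
  have hle : cellMeasure.real (hcross (n + 1) (m - 1)) ≤ cellMeasure.real F := by
    refine measure_le_of_comp_not (finite_box _ _ _ _) (determinedBy_crossing _ _ _)
      dual_injective ?_
    rintro ξ ⟨p, hp, q, hq, h⟩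
    simp only [Set.mem_ofPred_eq] at hp hq
    refine ⟨(p.2 + 1, p.1 - 1), by simp [hp], (q.2 + 1, q.1 - 1),
      by simp only [Set.mem_ofPred_eq]; omega, h.map _ dual_adj ?_⟩
    rintro z ⟨hz, hzb⟩
    refine ⟨notMem_black_of_dual hz, ?_⟩
    simp only [box, Set.mem_ofPred_eq] at hzb ⊢
    omega
  have hdisj : Disjoint (hcross m n) F := by
    rw [Set.disjoint_left]
    rintro ξ hξ hξF
    obtain ⟨z, hz, hz'⟩ := crossing_paths_meet (a := 0) (b := 2 * m) (c := 0) (d := 2 * n)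
      (S := black ξ ∩ box 0 (2 * m) 0 (2 * n))
      (T := (black ξ)ᶜ ∩ box 1 (2 * m - 1) (-1) (2 * n + 1)) (fun z hz => hz.2.2)
      (fun z hz => by have := hz.2.1; omega)
      (Joined.mono hξ subset_rfl (fun z hz => le_of_eq hz) (fun z hz => ge_of_eq hz))
      (Joined.mono hξF subset_rfl
        (fun z hz => by simp only [Set.mem_ofPred_eq] at hz ⊢; omega)
        (fun z hz => by simp only [Set.mem_ofPred_eq] at hz ⊢; omega))
    exact hz'.1 hz.1
  have h1 : cellMeasure.real (hcross m n ∪ F) = _ := measureReal_union' hdisj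
    ((determinedBy_crossing _ _ _).measurableSet (finite_box _ _ _ _))
  have h2 : cellMeasure.real (hcross m n ∪ F) ≤ 1 := measureReal_le_one
  linarith

/-! ### Exploring the leftmost crossing, and the reflection argument -/

/-- The white cells of `[0, 2n]²`, together with an additional column on the left. -/
def whiteRegion (n : ℤ) (ξ : ℤ × ℤ → Bool) : Set (ℤ × ℤ) :=
  {p | p ∈ box (-1) (2 * n) 0 (2 * n) ∧ (p.1 = -1 ∨ p ∉ black ξ)}

/-- The white cluster of the left side of `[0, 2n]²`. -/
def leftCluster (n : ℤ) (ξ : ℤ × ℤ → Bool) : Set (ℤ × ℤ) :=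
  {p | ∃ s : ℤ × ℤ, s.1 = -1 ∧ Linked (whiteRegion n ξ) s p}

/-- The edges whose colours are revealed by an exploration of the cluster `W`. -/
def explored (n : ℤ) (W : Set (ℤ × ℤ)) : Set (ℤ × ℤ) :=
  {p | (p.1 + p.2) % 2 = 1 ∧ p ∈ box (-1) (2 * n) 0 (2 * n) ∧
    ∃ w ∈ W, w = p ∨ squareLattice.Adj w p}

/-- The vertices of `[0, 2n]²` incident to an explored edge. -/
def clusterFrontier (n : ℤ) (W : Set (ℤ × ℤ)) : Set (ℤ × ℤ) :=
  {v | v.1 % 2 = 0 ∧ v.2 % 2 = 0 ∧ v ∈ box 0 (2 * n) 0 (2 * n) ∧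
    ∃ e ∈ explored n W, squareLattice.Adj e v}

/-- The reflection of `[0, 4n]²` in its horizontal axis. -/
def reflect (n : ℤ) (z : ℤ × ℤ) : ℤ × ℤ := (z.1, 4 * n - z.2)

theorem reflect_reflect (n : ℤ) (z : ℤ × ℤ) : reflect n (reflect n z) = z := by
  simp [reflect]

theorem reflect_adj (n : ℤ) (u v : ℤ × ℤ) (h : squareLattice.Adj u v) :
    squareLattice.Adj (reflect n u) (reflect n v) := by
  rw [squareLattice_adj_iff] at h ⊢
  simp only [reflect]
  omega

/-- The explored edges, the vertices incident to them, and the reflections of these. -/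
def exploredHull (n : ℤ) (W : Set (ℤ × ℤ)) : Set (ℤ × ℤ) :=
  {z | z ∈ explored n W ∪ clusterFrontier n W ∨ reflect n z ∈ explored n W ∪ clusterFrontier n W}

theorem reflect_mem_exploredHull {n : ℤ} {W : Set (ℤ × ℤ)} {z : ℤ × ℤ} :
    reflect n z ∈ exploredHull n W ↔ z ∈ exploredHull n W := by
  simp only [exploredHull, Set.mem_ofPred_eq, reflect_reflect]
  exact or_comm

/-- A black path from the frontier to the right side of `[0, 4n]²` through the unexplored
region. -/
def escape (n : ℤ) (W F : Set (ℤ × ℤ)) : Set (ℤ × ℤ → Bool) :=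
  {ξ | ∃ v ∈ F, ∃ q : ℤ × ℤ, q.1 = 4 * n ∧
    Linked ((black ξ ∩ box 0 (4 * n) 0 (4 * n)) \ exploredHull n W ∪ {v}) v q}

theorem determinedBy_escape (n : ℤ) (W F : Set (ℤ × ℤ)) :
    DeterminedBy (escape n W F) (box 0 (4 * n) 0 (4 * n) \ exploredHull n W) := by
  refine determinedBy_of_black fun ξ ξ' h => ?_
  rintro ⟨v, hv, q, hq, hl⟩
  refine ⟨v, hv, q, hq, ?_⟩
  rw [← Set.inter_sdiff_assoc, ← Set.inter_sdiff_assoc] at h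
  rwa [← h]

/-- The cluster `W` does not touch the right side of `[0, 2n]²`. -/
def Confined (n : ℤ) (W : Set (ℤ × ℤ)) : Prop := ∀ p ∈ W, p.1 ≠ 2 * n

theorem left_column_mem {n y : ℤ} {ξ : ℤ × ℤ → Bool} (hn : 0 ≤ n) (h0 : 0 ≤ y)
    (h1 : y ≤ 2 * n) : (-1, y) ∈ leftCluster n ξ := by
  refine ⟨(-1, y), rfl, Linked.refl ⟨?_, Or.inl rfl⟩⟩
  simp only [box, Set.mem_ofPred_eq]
  omega

theorem leftCluster_subset (n : ℤ) (ξ : ℤ × ℤ → Bool) : leftCluster n ξ ⊆ whiteRegion n ξ := by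
  rintro p ⟨s, -, hs⟩
  exact hs.right_mem

theorem leftCluster_step {n : ℤ} {ξ : ℤ × ℤ → Bool} {u v : ℤ × ℤ} (hu : u ∈ leftCluster n ξ)
    (ha : squareLattice.Adj u v) (hv : v ∈ whiteRegion n ξ) : v ∈ leftCluster n ξ := by
  obtain ⟨s, hs, hl⟩ := hu
  exact ⟨s, hs, hl.step hl.right_mem ha hv⟩

theorem linked_leftCluster {n : ℤ} {ξ : ℤ × ℤ → Bool} {p : ℤ × ℤ} (hp : p ∈ leftCluster n ξ) :
    ∃ s : ℤ × ℤ, s.1 = -1 ∧ Linked (leftCluster n ξ) s p := by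
  obtain ⟨s, hs, hl⟩ := hp
  exact ⟨s, hs, ((Linked.refl hl.1).in_cluster hl).mono
    fun w (hw : Linked _ s w) => (⟨s, hs, hw⟩ : w ∈ leftCluster n ξ)⟩

theorem whiteRegion_congr {n : ℤ} {W : Set (ℤ × ℤ)} {ξ ξ' : ℤ × ℤ → Bool}
    (h : ∀ p ∈ explored n W, ξ p = ξ' p) {w p : ℤ × ℤ} (hw : w ∈ W)
    (hwp : w = p ∨ squareLattice.Adj w p) : p ∈ whiteRegion n ξ ↔ p ∈ whiteRegion n ξ' := by
  refine and_congr_right fun hp => or_congr_right (not_congr ?_)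
  by_cases hm : (p.1 + p.2) % 2 = 1
  · exact black_congr (h p ⟨hm, hp, w, hw, hwp⟩)
  · simp only [mem_black, hm, false_and]

/-- Growing the cluster from the left column only queries cells in the cluster or adjacent to it, so
two colourings that agree on these cells grow the same cluster. -/
theorem determinedBy_leftCluster_eq (n : ℤ) (W : Set (ℤ × ℤ)) :
    DeterminedBy {ξ | leftCluster n ξ = W} (explored n W) := by
  rintro ξ ξ' h rfl
  have base : ∀ s : ℤ × ℤ, s.1 = -1 → (s ∈ whiteRegion n ξ ↔ s ∈ whiteRegion n ξ') :=
    fun s hs => and_congr_right fun _ => by simp only [hs, true_or]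
  refine Set.Subset.antisymm ?_ ?_
  · rintro p ⟨s, hs, hl⟩
    refine (hl.induction (motive := fun p => p ∈ leftCluster n ξ)
      ⟨s, hs, Linked.refl ((base s hs).2 hl.1)⟩ ?_)
    intro u v _ hv ha _ ih
    exact leftCluster_step ih ha ((whiteRegion_congr h ih (Or.inr ha)).2 hv)
  · rintro p ⟨s, hs, hl⟩
    refine (hl.induction (motive := fun p => p ∈ leftCluster n ξ')
      ⟨s, hs, Linked.refl ((base s hs).1 hl.1)⟩ ?_)
    intro u v _ hv ha hsu ih
    exact leftCluster_step ih ha ((whiteRegion_congr h ⟨s, hs, hsu⟩ (Or.inr ha)).1 hv)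

/-- A vertical crossing confines the white cluster of the left side. -/
theorem confined_of_vcross {n : ℤ} {ξ : ℤ × ℤ → Bool} (h : ξ ∈ vcross n n) :
    Confined n (leftCluster n ξ) := by
  rintro q ⟨p, hp, hl⟩ hq
  obtain ⟨z, hz, hz'⟩ := crossing_paths_meet (a := 0) (b := 2 * n) (c := 0) (d := 2 * n)
    (S := whiteRegion n ξ) (T := black ξ ∩ box 0 (2 * n) 0 (2 * n)) (fun z hz => hz.1.2)
    (fun z hz => hz.2.1)
    ⟨p, by simp only [Set.mem_ofPred_eq]; omega, q, ge_of_eq hq, hl⟩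
    (Joined.mono h subset_rfl (fun z hz => le_of_eq hz) (fun z hz => ge_of_eq hz))
  have := hz'.2.1
  rcases hz.2 with h | h
  · omega
  · exact h hz'.1

/-- Some vertical black crossing of `S`, which spans the heights from `c` to `d`, is connected
inside `R` to the column `e`. -/
def arm (S R : Set (ℤ × ℤ)) (c d e : ℤ) : Set (ℤ × ℤ → Bool) :=
  {ξ | ∃ v : ℤ × ℤ, (∃ s : ℤ × ℤ, s.2 = c ∧ Linked (black ξ ∩ S) v s) ∧
    (∃ t : ℤ × ℤ, t.2 = d ∧ Linked (black ξ ∩ S) v t) ∧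
    ∃ q : ℤ × ℤ, q.1 = e ∧ Linked (black ξ ∩ R) v q}

open Classical in
/-- The outer boundary of a confined cluster contains a vertical crossing. -/
theorem exists_boundary_crossing {n : ℤ} (hn : 1 ≤ n) {ξ : ℤ × ℤ → Bool}
    (h : Confined n (leftCluster n ξ)) :
    ∃ ξ' : ℤ × ℤ → Bool, ξ' ∈ vcross n n ∧
      (∀ p, ξ' p = true ↔ p ∉ leftCluster n ξ ∧ ∃ w ∈ leftCluster n ξ, squareLattice.Adj w p) := by
  refine ⟨fun p => decide (p ∉ leftCluster n ξ ∧ ∃ w ∈ leftCluster n ξ, squareLattice.Adj w p),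
    ?_, fun p => by simp⟩
  set ξ' : ℤ × ℤ → Bool := fun p =>
    decide (p ∉ leftCluster n ξ ∧ ∃ w ∈ leftCluster n ξ, squareLattice.Adj w p) with hξ'
  have hx : ∀ p, ξ' p = true ↔
      p ∉ leftCluster n ξ ∧ ∃ w ∈ leftCluster n ξ, squareLattice.Adj w p := fun p => by simp [hξ']
  -- Among edges, only those bordering the cluster are black for `ξ'`. A `ξ'`-white path entering
  -- from the left column can never leave the cluster, so a `ξ'`-white crossing would contradict
  -- confinement.
  rcases hex (K := (black ξ')ᶜ) (a := 0) (b := 2 * n) (c := 0) (d := 2 * n) (by omega) (by omega)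
    (fun x y _ _ _ _ => by
      simp only [Set.mem_compl_iff, not_iff_not]
      exact black_not_checkerboard ξ' x y) with ⟨p, hp, q, hq, hl⟩ | hj
  · exfalso
    have key : ∀ u v, u ∈ leftCluster n ξ → squareLattice.Adj u v →
        v ∈ (black ξ')ᶜ ∩ box 0 (2 * n) 0 (2 * n) → v ∈ leftCluster n ξ := by
      rintro u v hu ha ⟨hv, hvb⟩
      by_contra hvW
      refine hvW (leftCluster_step hu ha ⟨⟨⟨by have := hvb.1; omega, hvb.1.2⟩, hvb.2⟩,
        Or.inr fun hvξ => hv ?_⟩)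
      rw [mem_black] at hvξ ⊢
      exact hvξ.imp_right fun h => ⟨h.1, (hx v).2 ⟨hvW, u, hu, ha⟩⟩
    refine h q ?_ hq
    refine hl.induction (motive := fun z => z ∈ leftCluster n ξ) ?_
      fun u v _ hv ha _ ih => key u v ih ha hv
    refine key (-1, p.2) p (left_column_mem (by omega) hl.1.2.2.1 hl.1.2.2.2) ?_ hl.1
    exact squareLattice_adj_iff.2 (Or.inl ⟨by simpa using hp, rfl⟩)
  · rw [compl_compl] at hj
    exact hj

/-- The frontier vertex `v` where the escape starts must lie on the boundary crossing through `s`.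
Otherwise the cluster, the explored edge at `v` and the escape path form a left-right path that
avoids this crossing and its mirror image, whose union crosses [0, 4n]² from bottom to top. -/
theorem arm_of_escape {n : ℤ} (hn : 1 ≤ n) {ξ : ℤ × ℤ → Bool}
    (hc : Confined n (leftCluster n ξ))
    (h : ξ ∈ escape n (leftCluster n ξ) (clusterFrontier n (leftCluster n ξ))) :
    ξ ∈ arm (box 0 (2 * n) 0 (2 * n)) (box 0 (4 * n) 0 (4 * n)) 0 (2 * n) (4 * n) := by
  obtain ⟨ξ', ⟨s, hs, t, ht, hst⟩, hξ'⟩ := exists_boundary_crossing hn hc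
  simp only [Set.mem_ofPred_eq] at hs ht
  set W := leftCluster n ξ with hW
  set K := black ξ' ∩ box 0 (2 * n) 0 (2 * n) with hK
  have hKW : ∀ z ∈ K, z ∉ W := by
    rintro z ⟨hz, hzb⟩ hzW
    rcases (leftCluster_subset n ξ hzW).2 with h | h
    · have := hzb.1; omega
    · rw [mem_black] at hz h
      rcases hz with hz | hz
      · exact h (Or.inl hz)
      · exact ((hξ' z).1 hz.2).1 hzW
  have hKξ : K ⊆ black ξ ∩ box 0 (2 * n) 0 (2 * n) := by
    rintro z ⟨hz, hzb⟩
    refine ⟨?_, hzb⟩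
    by_contra hzξ
    rcases hz with hz | hz
    · exact hzξ (Or.inl hz)
    · obtain ⟨h1, w, hw, ha⟩ := (hξ' z).1 hz.2
      exact h1 (leftCluster_step hw ha ⟨⟨⟨by have := hzb.1; omega, hzb.1.2⟩, hzb.2⟩, Or.inr hzξ⟩)
  have hmixed : ∀ z ∈ K, (z.1 + z.2) % 2 = 1 → z ∈ explored n W := by
    rintro z ⟨hz, hzb⟩ hm
    obtain ⟨-, w, hw, ha⟩ := (hξ' z).1 ((mem_black_of_mixed hm).1 hz)
    exact ⟨hm, ⟨⟨by have := hzb.1; omega, hzb.1.2⟩, hzb.2⟩, w, hw, Or.inr ha⟩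
  -- The crossing consists of explored edges and their endpoints, so the escape path avoids it and
  -- its mirror image, except possibly at `v`.
  have hhull : ∀ z, Linked K s z → z ∈ explored n W ∪ clusterFrontier n W := by
    intro z hz
    have hzK := hz.right_mem
    rcases hzK.1 with hz' | hz'
    · right
      obtain ⟨r, hr, ha⟩ : ∃ r ∈ K, squareLattice.Adj z r := by
        by_cases hzs : z = s
        · exact (hz.symm.trans hst).exists_adj (by rintro rfl; subst hzs; omega)
        · exact hz.symm.exists_adj hzs
      refine ⟨hz'.1, hz'.2, hzK.2, r, hmixed r hr ?_, ha.symm⟩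
      rw [squareLattice_adj_iff] at ha
      omega
    · exact Or.inl (hmixed z hzK hz'.1)
  obtain ⟨v, hv, q, hq, hvq⟩ := h
  obtain ⟨hv1, hv2, hvb, e, he, hev⟩ := hv
  have heb := he.2.1
  obtain ⟨w, hw, hwe⟩ := he.2.2
  have hvK : v ∈ K := ⟨mem_black_of_even hv1 hv2, hvb⟩
  suffices hsv : Linked K s v by
    refine ⟨v, ⟨s, hs, (hsv.mono hKξ).symm⟩, ⟨t, ht, (hsv.symm.trans hst).mono hKξ⟩, q, hq,
      hvq.mono ?_⟩
    rintro z (hz | rfl)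
    · exact hz.1
    · exact ⟨mem_black_of_even hv1 hv2, ⟨⟨hvb.1.1, by have := hvb.1; omega⟩,
        hvb.2.1, by have := hvb.2; omega⟩⟩
  by_contra hsv
  obtain ⟨w₀, hw₀, hww⟩ := linked_leftCluster hw
  set S : Set (ℤ × ℤ) := W ∪ {e} ∪
    ((black ξ ∩ box 0 (4 * n) 0 (4 * n)) \ exploredHull n W ∪ {v}) with hS
  have hlS : Linked S w₀ q := by
    have h1 : Linked S w₀ w := hww.mono fun z hz => Or.inl (Or.inl hz)
    have h2 : Linked S w e := by
      rcases hwe with rfl | ha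
      · exact Linked.refl h1.right_mem
      · exact Linked.of_adj h1.right_mem ha (Or.inl (Or.inr rfl))
    have h3 : Linked S e v := Linked.of_adj h2.right_mem hev (Or.inr (Or.inr rfl))
    exact ((h1.trans h2).trans h3).trans (hvq.mono fun z hz => Or.inr hz)
  set T : Set (ℤ × ℤ) := {z | Linked K s z ∨ Linked K s (reflect n z)} with hT
  have hlT : Linked T s (reflect n s) := by
    have h1 : Linked T s t := ((Linked.refl hst.1).in_cluster hst).mono fun z hz => Or.inl hz
    have h2 : Linked T (reflect n s) (reflect n t) :=
      ((Linked.refl hst.1).in_cluster hst).map _ (reflect_adj n) fun z hz => Or.inr (by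
        rw [reflect_reflect]; exact hz)
    have h3 : reflect n t = t := Prod.ext rfl (by simp only [reflect]; omega)
    rw [h3] at h2
    exact h1.trans h2.symm
  have hdis : ∀ z ∈ S, z ∈ box (-1) (4 * n) 0 (4 * n) ∧ ¬ Linked K s z ∧
      (z.2 ≤ 2 * n ∨ z ∉ exploredHull n W) := by
    rintro z ((hz | rfl) | (hz | rfl))
    · have hzb := (leftCluster_subset n ξ hz).1
      refine ⟨⟨⟨hzb.1.1, by have := hzb.1; omega⟩, hzb.2.1, by have := hzb.2; omega⟩,
        fun hl => hKW z hl.right_mem hz, Or.inl hzb.2.2⟩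
    · exact ⟨⟨⟨heb.1.1, by have := heb.1; omega⟩, heb.2.1, by have := heb.2; omega⟩,
        fun hl => hsv (hl.step hl.right_mem hev hvK), Or.inl heb.2.2⟩
    · have hzb := hz.1.2
      exact ⟨⟨⟨by have := hzb.1; omega, hzb.1.2⟩, hzb.2⟩, fun hl => hz.2 (Or.inl (hhull z hl)),
        Or.inr hz.2⟩
    · exact ⟨⟨⟨by have := hvb.1; omega, by have := hvb.1; omega⟩, hvb.2.1,
        by have := hvb.2; omega⟩, hsv, Or.inl hvb.2.2⟩
  obtain ⟨z, hzS, hzT⟩ := crossing_paths_meet (a := 0) (b := 4 * n) (c := 0) (d := 4 * n)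
    (S := S) (T := T) (fun z hz => (hdis z hz).1.2)
    (by
      rintro z (hz | hz)
      · have := hz.right_mem.2.1; omega
      · have := hz.right_mem.2.1; simp only [reflect] at this; omega)
    ⟨w₀, by simp only [Set.mem_ofPred_eq]; omega, q, ge_of_eq hq, hlS⟩
    ⟨s, le_of_eq hs, reflect n s, by simp only [Set.mem_ofPred_eq, reflect]; omega, hlT⟩
  obtain ⟨-, h1, h2⟩ := hdis z hzS
  rcases hzT with hzT | hzT
  · exact h1 hzT
  -- The mirror image lies at heights at least 2n, so a point at height at most 2n meets it only on
  -- the axis, where it coincides with the crossing itself.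
  · rcases h2 with h2 | h2
    · have hz2 := hzT.right_mem.2.2
      simp only [reflect] at hz2
      have h3 : reflect n z = z := Prod.ext rfl (by simp only [reflect]; omega)
      rw [h3] at hzT
      exact h1 hzT
    · exact h2 (Or.inr (hhull _ hzT))

theorem clusterFrontier_of_adj {n : ℤ} {W : Set (ℤ × ℤ)} {v r : ℤ × ℤ} (hv : v ∈ explored n W)
    (ha : squareLattice.Adj v r) (h1 : r.1 % 2 = 0) (h2 : r.2 % 2 = 0) (h3 : 0 ≤ r.1) :
    r ∈ clusterFrontier n W := by
  refine ⟨h1, h2, ?_, v, hv, ha⟩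
  have hb := hv.2.1
  simp only [box, Set.mem_ofPred_eq] at hb ⊢
  rw [squareLattice_adj_iff] at ha
  omega

/-- A horizontal crossing starts in the hull, because its left side borders the column -1 or the
mirror image of that column. At its last visit to the hull it cannot be at an edge, since the next
cell would be an endpoint of that edge and still in the hull. So it leaves from a frontier vertex or
from the mirror image of one. -/
theorem hcross_subset_escape {n : ℤ} (hn : 1 ≤ n) {W : Set (ℤ × ℤ)}
    (hW : ∀ y, 0 ≤ y → y ≤ 2 * n → (-1, y) ∈ W) :
    hcross (2 * n) (2 * n) ⊆
      escape n W (clusterFrontier n W) ∪ escape n W {z | reflect n z ∈ clusterFrontier n W} := by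
  rintro ξ ⟨p, hp, q, hq, hl⟩
  simp only [Set.mem_ofPred_eq] at hp hq
  rw [show 2 * (2 * n) = 4 * n by ring] at hl hq
  have hex : ∀ y, 0 ≤ y → y ≤ 2 * n → (0, y) ∈ black ξ →
      (0, y) ∈ explored n W ∪ clusterFrontier n W := by
    intro y h0 h1 hb
    by_cases hy : y % 2 = 0
    · right
      refine ⟨rfl, hy, ⟨⟨le_rfl, by simp only; omega⟩, h0, h1⟩, (-1, y), ⟨by simp only; omega,
        ⟨⟨le_rfl, by simp only; omega⟩, h0, h1⟩, _, hW y h0 h1, Or.inl rfl⟩,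
        squareLattice_adj_iff.2 (Or.inl ⟨rfl, rfl⟩)⟩
    · left
      exact ⟨by simp only; omega, ⟨⟨by simp only; omega, by simp only; omega⟩, h0, h1⟩, _,
        hW y h0 h1, Or.inr (squareLattice_adj_iff.2 (Or.inl ⟨rfl, rfl⟩))⟩
  have hpT : p ∈ exploredHull n W := by
    obtain ⟨hpb, hpx⟩ := hl.1
    have hp' : p = (0, p.2) := Prod.ext hp rfl
    by_cases hy : p.2 ≤ 2 * n
    · left
      rw [hp']
      exact hex p.2 hpx.2.1 hy (hp' ▸ hpb)
    · right
      have h2 := hpx.2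
      have hr : reflect n p = (0, 4 * n - p.2) := Prod.ext hp rfl
      rw [hr]
      by_cases hpar : p.2 % 2 = 0
      · have hbl : ((0, 4 * n - p.2) : ℤ × ℤ) ∈ black ξ :=
          mem_black_of_even rfl (by simp only; omega)
        exact hex _ (by omega) (by omega) hbl
      · refine Or.inl ⟨by simp only; omega, ⟨⟨by simp only; omega, by simp only; omega⟩,
          by simp only; omega, by simp only; omega⟩, _, hW (4 * n - p.2) (by omega) (by omega),
          Or.inr (squareLattice_adj_iff.2 (Or.inl ⟨rfl, rfl⟩))⟩
  obtain ⟨v, hvT, hvS, hvq⟩ := hl.last_exit hpT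
  have hnext : v ≠ q → ∃ r, squareLattice.Adj v r ∧ r ∈ black ξ ∩ box 0 (4 * n) 0 (4 * n) ∧
      r ∉ exploredHull n W := by
    intro hne
    obtain ⟨r, hr | hr, ha⟩ := hvq.exists_adj hne
    · exact ⟨r, ha, hr.1, hr.2⟩
    · rw [hr] at ha
      exact absurd rfl ha.ne
  have hv4 : ∀ u, u.1 = v.1 → u ∈ explored n W → v ≠ q := by
    rintro u hu hue rfl
    have := hue.2.1.1
    omega
  rcases hvT with (hv | hv) | (hv | hv)
  · exfalso
    obtain ⟨r, ha, hr, hrT⟩ := hnext (hv4 v rfl hv)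
    have ha' := squareLattice_adj_iff.1 ha
    have hm := hv.1
    rcases hr.1 with h | h
    · exact hrT (Or.inl (Or.inr (clusterFrontier_of_adj hv ha h.1 h.2 hr.2.1.1)))
    · omega
  · exact Or.inl ⟨v, hv, q, hq, hvq⟩
  · exfalso
    obtain ⟨r, ha, hr, hrT⟩ := hnext (hv4 (reflect n v) rfl hv)
    have ha' := squareLattice_adj_iff.1 ha
    have hm := hv.1
    simp only [reflect] at hm
    rcases hr.1 with h | h
    · exact hrT (Or.inr (Or.inr (clusterFrontier_of_adj hv (reflect_adj n _ _ ha) h.1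
        (by simp only [reflect]; omega) hr.2.1.1)))
    · omega
  · exact Or.inr ⟨v, hv, q, hq, hvq⟩

/-- The hull was made symmetric so that the reflection carries escapes from the mirrored frontier to
escapes from the frontier. -/
theorem hcross_le_two_mul_escape {n : ℤ} (hn : 1 ≤ n) {W : Set (ℤ × ℤ)}
    (hW : ∀ y, 0 ≤ y → y ≤ 2 * n → (-1, y) ∈ W) :
    cellMeasure.real (hcross (2 * n) (2 * n)) ≤
      2 * cellMeasure.real (escape n W (clusterFrontier n W)) := by
  have h1 : cellMeasure.real (escape n W {z | reflect n z ∈ clusterFrontier n W}) ≤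
      cellMeasure.real (escape n W (clusterFrontier n W)) := by
    refine measure_le_of_comp ((finite_box _ _ _ _).subset Set.sdiff_subset)
      (determinedBy_escape _ _ _) (f := reflect n)
      (Function.LeftInverse.injective (reflect_reflect n)) ?_
    rintro ξ ⟨v, hv, q, hq, hl⟩
    refine ⟨reflect n v, hv, reflect n q, hq, hl.map _ (reflect_adj n) ?_⟩
    rintro u (⟨⟨hu, hub⟩, huT⟩ | rfl)
    · refine Or.inl ⟨⟨?_, hub.1, ?_⟩, fun h => huT (reflect_mem_exploredHull.1 h)⟩
      · rw [mem_black] at hu ⊢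
        refine hu.imp (fun h => ⟨h.1, ?_⟩) fun h => ⟨?_, h.2⟩
        · have := h.2; simp only [reflect]; omega
        · have := h.1; simp only [reflect]; omega
      · have := hub.2; simp only [reflect]; omega
    · exact Or.inr rfl
  have h2 := measureReal_mono (μ := cellMeasure) (hcross_subset_escape hn hW)
  have h3 := measureReal_union_le (μ := cellMeasure) (escape n W (clusterFrontier n W))
    (escape n W {z | reflect n z ∈ clusterFrontier n W})
  linarith

theorem explored_subset_hull (n : ℤ) (W : Set (ℤ × ℤ)) : explored n W ⊆ exploredHull n W :=
  fun _ h => Or.inl (Or.inl h)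

/-- Conditioning on the white cluster of the left side of the square `[0, n]²`, a vertical
crossing of it is connected to the right side of `[0, 2n]²` with conditional probability at
least half the probability that `[0, 2n]²` is crossed horizontally. -/
theorem vcross_mul_hcross_le_arm {n : ℤ} (hn : 1 ≤ n) :
    cellMeasure.real (vcross n n) * cellMeasure.real (hcross (2 * n) (2 * n)) ≤
      2 * cellMeasure.real
        (arm (box 0 (2 * n) 0 (2 * n)) (box 0 (4 * n) 0 (4 * n)) 0 (2 * n) (4 * n)) := by
  classical
  set X := arm (box 0 (2 * n) 0 (2 * n)) (box 0 (4 * n) 0 (4 * n)) 0 (2 * n) (4 * n) with hX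
  have hfin : {W | (∃ ξ, leftCluster n ξ = W) ∧ Confined n W}.Finite := by
    refine ((finite_box (-1) (2 * n) 0 (2 * n)).finite_subsets).subset ?_
    rintro W ⟨⟨ξ, rfl⟩, -⟩ p hp
    exact (leftCluster_subset n ξ hp).1
  set 𝒲 := hfin.toFinset with h𝒲
  have hmem : ∀ W, W ∈ 𝒲 ↔ (∃ ξ, leftCluster n ξ = W) ∧ Confined n W := fun W => by
    rw [h𝒲, Set.Finite.mem_toFinset]; rfl
  set L : Set (ℤ × ℤ) → Set (ℤ × ℤ → Bool) := fun W => {ξ | leftCluster n ξ = W} with hL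
  set E : Set (ℤ × ℤ) → Set (ℤ × ℤ → Bool) := fun W => escape n W (clusterFrontier n W) with hE
  have hexp : ∀ W, (explored n W).Finite := fun W =>
    (finite_box (-1) (2 * n) 0 (2 * n)).subset fun p hp => hp.2.1
  have hun : ∀ W, (box 0 (4 * n) 0 (4 * n) \ exploredHull n W).Finite := fun W =>
    (finite_box _ _ _ _).subset Set.sdiff_subset
  have hLm : ∀ W, MeasurableSet (L W) := fun W =>
    (determinedBy_leftCluster_eq n W).measurableSet (hexp W)
  have hEm : ∀ W, MeasurableSet (E W) := fun W => (determinedBy_escape _ _ _).measurableSet (hun W)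
  -- The cluster event depends on explored cells only, and the escape event only on cells outside
  -- the hull.
  have hind : ∀ W, cellMeasure.real (L W ∩ E W) = cellMeasure.real (L W) * cellMeasure.real (E W) :=
    fun W => (determinedBy_leftCluster_eq n W).indep (hexp W) (hun W) (determinedBy_escape _ _ _)
      (Set.disjoint_left.2 fun z hz hz' => hz'.2 (explored_subset_hull n W hz))
  have hdisj : ∀ W W', W ≠ W' → Disjoint (L W) (L W') := fun W W' hne =>
    Set.disjoint_left.2 fun ξ h h' => hne (h.symm.trans h')
  have hV : cellMeasure.real (vcross n n) ≤ ∑ W ∈ 𝒲, cellMeasure.real (L W) := by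
    rw [← measureReal_biUnion_finset (fun W _ W' _ hne => hdisj W W' hne) fun W _ => hLm W]
    refine measureReal_mono (fun ξ hξ => ?_) (measure_ne_top _ _)
    simp only [Set.mem_iUnion]
    exact ⟨_, (hmem _).2 ⟨⟨ξ, rfl⟩, confined_of_vcross hξ⟩, rfl⟩
  have hXle : ∑ W ∈ 𝒲, cellMeasure.real (L W ∩ E W) ≤ cellMeasure.real X := by
    rw [← measureReal_biUnion_finset (fun W _ W' _ hne => (hdisj W W' hne).mono
      Set.inter_subset_left Set.inter_subset_left) fun W _ => (hLm W).inter (hEm W)]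
    refine measureReal_mono fun ξ hξ => ?_
    simp only [Set.mem_iUnion] at hξ
    obtain ⟨W, hW, hξL, hξE⟩ := hξ
    obtain rfl : leftCluster n ξ = W := hξL
    exact arm_of_escape hn ((hmem _).1 hW).2 hξE
  calc cellMeasure.real (vcross n n) * cellMeasure.real (hcross (2 * n) (2 * n))
      ≤ (∑ W ∈ 𝒲, cellMeasure.real (L W)) * cellMeasure.real (hcross (2 * n) (2 * n)) :=
        mul_le_mul_of_nonneg_right hV measureReal_nonneg
    _ = ∑ W ∈ 𝒲, cellMeasure.real (L W) * cellMeasure.real (hcross (2 * n) (2 * n)) :=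
        Finset.sum_mul _ _ _
    _ ≤ ∑ W ∈ 𝒲, 2 * cellMeasure.real (L W ∩ E W) := by
        refine Finset.sum_le_sum fun W hW => ?_
        obtain ⟨⟨ξ, rfl⟩, -⟩ := (hmem W).1 hW
        rw [hind]
        have := mul_le_mul_of_nonneg_left (hcross_le_two_mul_escape hn (W := leftCluster n ξ)
          fun y h0 h1 => left_column_mem (by omega) h0 h1)
          (measureReal_nonneg (μ := cellMeasure) (s := L (leftCluster n ξ)))
        linarith
    _ = 2 * ∑ W ∈ 𝒲, cellMeasure.real (L W ∩ E W) := (Finset.mul_sum _ _ _).symm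
    _ ≤ 2 * cellMeasure.real X := by linarith

/-! ### Rectangles of ratio 3 : 2 -/

theorem isUpperSet_arm (S R : Set (ℤ × ℤ)) (c d e : ℤ) : IsUpperSet (arm S R c d e) := by
  rintro ξ ξ' h ⟨v, ⟨s, hs, h1⟩, ⟨t, ht, h2⟩, q, hq, h3⟩
  exact ⟨v, ⟨s, hs, h1.mono (Set.inter_subset_inter_left _ (black_mono h))⟩,
    ⟨t, ht, h2.mono (Set.inter_subset_inter_left _ (black_mono h))⟩,
    q, hq, h3.mono (Set.inter_subset_inter_left _ (black_mono h))⟩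

theorem determinedBy_arm {S R : Set (ℤ × ℤ)} (c d e : ℤ) (hSR : S ⊆ R) :
    DeterminedBy (arm S R c d e) R := by
  refine determinedBy_of_black fun ξ ξ' h => ?_
  have h' : black ξ ∩ S = black ξ' ∩ S := by
    have := congrArg (· ∩ S) h
    simpa only [Set.inter_assoc, Set.inter_eq_right.2 hSR] using this
  rintro ⟨v, h1, h2, h3⟩
  rw [h'] at h1 h2
  rw [h] at h3
  exact ⟨v, h1, h2, h3⟩

/-- Applied to a translation by 2n and to the reflection x ↦ 4n - x; both preserve the parities that
distinguish vertices, edges and faces. -/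
theorem measure_arm_le {S R S' R' : Set (ℤ × ℤ)} {c d e e' : ℤ} (hR : R.Finite) (hSR : S ⊆ R)
    {f : ℤ × ℤ → ℤ × ℤ} (hf : Function.Injective f)
    (ha : ∀ u v, squareLattice.Adj u v → squareLattice.Adj (f u) (f v))
    (hpar : ∀ u, (f u).1 % 2 = u.1 % 2 ∧ (f u).2 = u.2)
    (hS : ∀ u ∈ S, f u ∈ S') (hRR : ∀ u ∈ R, f u ∈ R') (he : ∀ u : ℤ × ℤ, u.1 = e → (f u).1 = e') :
    cellMeasure.real (arm S R c d e) ≤ cellMeasure.real (arm S' R' c d e') := by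
  refine measure_le_of_comp hR (determinedBy_arm c d e hSR) hf ?_
  have hb : ∀ ξ : ℤ × ℤ → Bool, ∀ u ∈ black fun k => ξ (f k), f u ∈ black ξ := by
    intro ξ u hu
    rw [mem_black] at hu ⊢
    obtain ⟨h1, h2⟩ := hpar u
    exact hu.imp (fun h => ⟨by omega, by omega⟩) fun h => ⟨by omega, h.2⟩
  rintro ξ ⟨v, ⟨s, hs, h1⟩, ⟨t, ht, h2⟩, q, hq, h3⟩
  exact ⟨f v, ⟨f s, by rw [(hpar s).2, hs], h1.map f ha fun u hu => ⟨hb ξ u hu.1, hS u hu.2⟩⟩,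
    ⟨f t, by rw [(hpar t).2, ht], h2.map f ha fun u hu => ⟨hb ξ u hu.1, hS u hu.2⟩⟩,
    f q, he q hq, h3.map f ha fun u hu => ⟨hb ξ u hu.1, hRR u hu.2⟩⟩

/-- Invariance of crossing probabilities under translations by even vectors. -/
theorem measure_crossing_shift_le {R A B R' A' B' : Set (ℤ × ℤ)} (hR : R.Finite) (k : ℤ)
    (hRR : ∀ u ∈ R, (u.1 + 2 * k, u.2) ∈ R') (hA : ∀ u ∈ A, (u.1 + 2 * k, u.2) ∈ A')
    (hB : ∀ u ∈ B, (u.1 + 2 * k, u.2) ∈ B') :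
    cellMeasure.real (crossing R A B) ≤ cellMeasure.real (crossing R' A' B') := by
  refine measure_le_of_comp hR (determinedBy_crossing _ _ _) (f := fun u => (u.1 + 2 * k, u.2)) ?_ ?_
  · rintro ⟨a, b⟩ ⟨c, d⟩ h
    simp only [Prod.mk.injEq] at h ⊢
    omega
  · rintro ξ ⟨p, hp, q, hq, h⟩
    refine ⟨_, hA p hp, _, hB q hq, h.map (fun u => (u.1 + 2 * k, u.2)) ?_ ?_⟩
    · intro u v ha
      rw [squareLattice_adj_iff] at ha ⊢
      simp only
      omega
    · rintro u ⟨hu, hub⟩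
      refine ⟨?_, hRR u hub⟩
      rw [mem_black] at hu ⊢
      exact hu.imp (fun h => ⟨by simp only; omega, h.2⟩) fun h => ⟨by simp only; omega, h.2⟩

/-- A horizontal and a vertical black crossing of a rectangle belong to the same cluster. -/
theorem crossings_linked {ξ : ℤ × ℤ → Bool} {a b c d : ℤ} {p q s t : ℤ × ℤ}
    (hp : p.1 = a) (hq : q.1 = b) (hs : s.2 = c) (ht : t.2 = d)
    {R S : Set (ℤ × ℤ)} (hRy : ∀ z ∈ R, c ≤ z.2 ∧ z.2 ≤ d) (hSx : ∀ z ∈ S, a ≤ z.1 ∧ z.1 ≤ b)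
    {U : Set (ℤ × ℤ)} (hRU : R ⊆ U) (hSU : S ⊆ U)
    (hpq : Linked (black ξ ∩ R) p q) (hst : Linked (black ξ ∩ S) s t) :
    Linked (black ξ ∩ U) p s := by
  obtain ⟨z, hz, hz'⟩ := crossing_paths_meet (a := a) (b := b) (c := c) (d := d)
    (S := {w | Linked (black ξ ∩ R) p w}) (T := {w | Linked (black ξ ∩ S) s w})
    (fun z hz => hRy z (Linked.right_mem hz).2) (fun z hz => hSx z (Linked.right_mem hz).2)
    ⟨p, le_of_eq hp, q, ge_of_eq hq, (Linked.refl hpq.1).in_cluster hpq⟩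
    ⟨s, le_of_eq hs, t, ge_of_eq ht, (Linked.refl hst.1).in_cluster hst⟩
  exact (Linked.mono (Set.inter_subset_inter_right _ hRU) hz).trans
    (Linked.mono (Set.inter_subset_inter_right _ hSU) hz').symm

theorem box_subset_box {a b c d a' b' c' d' : ℤ} (h1 : a' ≤ a) (h2 : b ≤ b') (h3 : c' ≤ c)
    (h4 : d ≤ d') : box a b c d ⊆ box a' b' c' d' := by
  intro z hz
  simp only [box, Set.mem_ofPred_eq] at hz ⊢
  omega

/-- The rectangle `[0, 3n] × [0, 2n]` is crossed horizontally with probability at least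
`1/128`. -/
theorem hcross_three_two {n : ℤ} (hn : 1 ≤ n) :
    1 / 128 ≤ cellMeasure.real (hcross (3 * n) (2 * n)) := by
  have h0 := vcross_mul_hcross_le_arm hn
  set S := box (2 * n) (4 * n) 0 (2 * n) with hS
  -- Both arms are anchored at vertical crossings of the same middle square `S`, one reaching the
  -- far right and one the far left. Any horizontal crossing of `S` meets both vertical crossings
  -- and joins the arms.
  set X₁ := arm S (box (2 * n) (6 * n) 0 (4 * n)) 0 (2 * n) (6 * n) with hX₁
  set X₂ := arm S (box 0 (4 * n) 0 (4 * n)) 0 (2 * n) 0 with hX₂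
  set Y := crossing S {z | z.1 = 2 * n} {z | z.1 = 4 * n} with hY
  set U := box 0 (6 * n) 0 (4 * n) with hU
  have hfin : U.Finite := finite_box _ _ _ _
  have hv : 1 / 2 ≤ cellMeasure.real (vcross n n) := (half_le_hcross hn).trans (hcross_le_vcross n n)
  have hh : 1 / 2 ≤ cellMeasure.real (hcross (2 * n) (2 * n)) := half_le_hcross (by omega)
  have hmul : (1 / 2 : ℝ) * (1 / 2) ≤
      cellMeasure.real (vcross n n) * cellMeasure.real (hcross (2 * n) (2 * n)) :=
    mul_le_mul hv hh (by norm_num) (by linarith)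
  have hsub : box 0 (2 * n) 0 (2 * n) ⊆ box 0 (4 * n) 0 (4 * n) :=
    box_subset_box le_rfl (by omega) le_rfl (by omega)
  have e1 : 1 / 8 ≤ cellMeasure.real X₁ := by
    have : cellMeasure.real _ ≤ cellMeasure.real X₁ :=
      measure_arm_le (S := box 0 (2 * n) 0 (2 * n)) (R := box 0 (4 * n) 0 (4 * n)) (e := 4 * n)
        (f := fun u => (u.1 + 2 * n, u.2)) (finite_box _ _ _ _) hsub
        (by rintro ⟨a, b⟩ ⟨c, d⟩ h; simp only [Prod.mk.injEq] at h ⊢; omega)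
        (by intro u v h; rw [squareLattice_adj_iff] at h ⊢; simp only; omega)
        (fun u => ⟨by simp only; omega, rfl⟩)
        (by intro u hu; simp only [hS, box, Set.mem_ofPred_eq] at hu ⊢; omega)
        (by intro u hu; simp only [box, Set.mem_ofPred_eq] at hu ⊢; omega)
        (by intro u hu; simp only; omega)
    linarith
  have e2 : 1 / 8 ≤ cellMeasure.real X₂ := by
    have : cellMeasure.real _ ≤ cellMeasure.real X₂ :=
      measure_arm_le (S := box 0 (2 * n) 0 (2 * n)) (R := box 0 (4 * n) 0 (4 * n)) (e := 4 * n)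
        (f := fun u => (4 * n - u.1, u.2)) (finite_box _ _ _ _) hsub
        (by rintro ⟨a, b⟩ ⟨c, d⟩ h; simp only [Prod.mk.injEq] at h ⊢; omega)
        (by intro u v h; rw [squareLattice_adj_iff] at h ⊢; simp only; omega)
        (fun u => ⟨by simp only; omega, rfl⟩)
        (by intro u hu; simp only [hS, box, Set.mem_ofPred_eq] at hu ⊢; omega)
        (by intro u hu; simp only [box, Set.mem_ofPred_eq] at hu ⊢; omega)
        (by intro u hu; simp only; omega)
    linarith
  have e3 : 1 / 2 ≤ cellMeasure.real Y := by
    refine (half_le_hcross hn).trans (measure_crossing_shift_le (finite_box _ _ _ _) n ?_ ?_ ?_)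
    · intro u hu; simp only [hS, box, Set.mem_ofPred_eq] at hu ⊢; omega
    · intro u hu; simp only [Set.mem_ofPred_eq] at hu ⊢; omega
    · intro u hu; simp only [Set.mem_ofPred_eq] at hu ⊢; omega
  have hSU : S ⊆ U := box_subset_box (by omega) (by omega) le_rfl (by omega)
  have hR₁ : box (2 * n) (6 * n) 0 (4 * n) ⊆ U :=
    box_subset_box (by omega) le_rfl le_rfl le_rfl
  have hR₂ : box 0 (4 * n) 0 (4 * n) ⊆ U := box_subset_box le_rfl (by omega) le_rfl le_rfl
  have d1 : DeterminedBy X₁ U := (determinedBy_arm _ _ _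
    (box_subset_box le_rfl (by omega) le_rfl (by omega))).mono hR₁
  have d2 : DeterminedBy X₂ U := (determinedBy_arm _ _ _
    (box_subset_box (by omega) le_rfl le_rfl (by omega))).mono hR₂
  have d3 : DeterminedBy Y U := (determinedBy_crossing _ _ _).mono hSU
  have u1 : IsUpperSet X₁ := isUpperSet_arm _ _ _ _ _
  have u2 : IsUpperSet X₂ := isUpperSet_arm _ _ _ _ _
  have i1 := harris hfin d1 d2 u1 u2
  have i2 := harris hfin (d1.inter d2) d3 (u1.inter u2) (isUpperSet_crossing _ _ _)
  have hfinal : X₁ ∩ X₂ ∩ Y ⊆ hcross (3 * n) (2 * n) := by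
    rintro ξ ⟨⟨⟨v₁, ⟨s₁, hs₁, l₁⟩, ⟨t₁, ht₁, m₁⟩, q₁, hq₁, r₁⟩,
      v₂, ⟨s₂, hs₂, l₂⟩, ⟨t₂, ht₂, m₂⟩, q₂, hq₂, r₂⟩, p, hp, q, hq, hpq⟩
    have hx : ∀ z ∈ S, 2 * n ≤ z.1 ∧ z.1 ≤ 4 * n := fun z hz => hz.1
    have hy : ∀ z ∈ S, 0 ≤ z.2 ∧ z.2 ≤ 2 * n := fun z hz => hz.2
    have k₁ := crossings_linked hp hq hs₁ ht₁ hy hx subset_rfl subset_rfl hpq (l₁.symm.trans m₁)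
    have k₂ := crossings_linked hp hq hs₂ ht₂ hy hx subset_rfl subset_rfl hpq (l₂.symm.trans m₂)
    have hU' : box 0 (2 * (3 * n)) 0 (2 * (2 * n)) = U := by rw [hU]; congr 1 <;> ring
    refine ⟨q₂, hq₂, q₁, by simp only [Set.mem_ofPred_eq]; omega, ?_⟩
    rw [hU']
    have hSS : black ξ ∩ S ⊆ black ξ ∩ U := Set.inter_subset_inter_right _ hSU
    exact ((r₂.mono (Set.inter_subset_inter_right _ hR₂)).symm.trans
      ((l₂.trans k₂.symm).trans (k₁.trans l₁.symm) |>.mono hSS)).trans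
      (r₁.mono (Set.inter_subset_inter_right _ hR₁))
  have j1 : (1 / 8 : ℝ) * (1 / 8) ≤ cellMeasure.real X₁ * cellMeasure.real X₂ :=
    mul_le_mul e1 e2 (by norm_num) (by linarith)
  have j2 : (1 / 64 : ℝ) * (1 / 2) ≤ cellMeasure.real (X₁ ∩ X₂) * cellMeasure.real Y :=
    mul_le_mul (by linarith) e3 (by norm_num) measureReal_nonneg
  have j3 : cellMeasure.real (X₁ ∩ X₂ ∩ Y) ≤ cellMeasure.real (hcross (3 * n) (2 * n)) :=
    measureReal_mono hfinal
  linarith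

/-! ### Rectangles of arbitrary ratio -/

theorem hcross_anti {m m' n : ℤ} (hm : 0 ≤ m) (h : m ≤ m') : hcross m' n ⊆ hcross m n := by
  rintro ξ ⟨p, hp, q, hq, hl⟩
  simp only [Set.mem_ofPred_eq] at hp hq
  obtain ⟨r, hr, hpr⟩ := hl.first_hit (b := 2 * m) (by omega) (by omega)
  refine ⟨p, hp, r, hr, hpr.mono ?_⟩
  rintro z ⟨⟨hz, hzb⟩, hzm⟩
  exact ⟨hz, ⟨hzb.1.1, hzm⟩, hzb.2⟩

theorem hcross_mono {m n n' : ℤ} (h : n ≤ n') : hcross m n ⊆ hcross m n' :=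
  crossing_mono (box_subset_box le_rfl le_rfl le_rfl (by omega)) subset_rfl subset_rfl

/-- Gluing horizontal crossings of overlapping rectangles. -/
theorem hcross_glue {a m : ℤ} (ha : 1 ≤ a) (hm : 2 * a ≤ m) :
    cellMeasure.real (hcross m (2 * a)) / 256 ≤ cellMeasure.real (hcross (m + a) (2 * a)) := by
  -- A 3a × 2a rectangle overlaps the old one in a square of side 2a. A vertical crossing of that
  -- square joins the two horizontal crossings, at the cost of a factor 1/128 · 1/2 = 1/256.
  set R := box (2 * (m - 2 * a)) (2 * (m + a)) 0 (2 * (2 * a)) with hR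
  set S := box (2 * (m - 2 * a)) (2 * m) 0 (2 * (2 * a)) with hS
  set U := box 0 (2 * (m + a)) 0 (2 * (2 * a)) with hU
  set H := crossing R {z | z.1 = 2 * (m - 2 * a)} {z | z.1 = 2 * (m + a)} with hH
  set V := crossing S {z | z.2 = 0} {z | z.2 = 2 * (2 * a)} with hV
  have e1 : 1 / 128 ≤ cellMeasure.real H := by
    refine (hcross_three_two ha).trans
      (measure_crossing_shift_le (finite_box _ _ _ _) (m - 2 * a) ?_ ?_ ?_)
    · intro u hu; simp only [hR, box, Set.mem_ofPred_eq] at hu ⊢; omega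
    · intro u hu; simp only [Set.mem_ofPred_eq] at hu ⊢; omega
    · intro u hu; simp only [Set.mem_ofPred_eq] at hu ⊢; omega
  have e2 : 1 / 2 ≤ cellMeasure.real V := by
    refine ((half_le_hcross (by omega)).trans (hcross_le_vcross (2 * a) (2 * a))).trans
      (measure_crossing_shift_le (finite_box _ _ _ _) (m - 2 * a) ?_ ?_ ?_)
    · intro u hu; simp only [hS, box, Set.mem_ofPred_eq] at hu ⊢; omega
    · intro u hu; simp only [Set.mem_ofPred_eq] at hu ⊢; omega
    · intro u hu; simp only [Set.mem_ofPred_eq] at hu ⊢; omega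
  have hRU : R ⊆ U := box_subset_box (by omega) le_rfl le_rfl le_rfl
  have hSU : S ⊆ U := box_subset_box (by omega) (by omega) le_rfl le_rfl
  have hmU : box 0 (2 * m) 0 (2 * (2 * a)) ⊆ U := box_subset_box le_rfl (by omega) le_rfl le_rfl
  have d1 : DeterminedBy (hcross m (2 * a)) U := (determinedBy_crossing _ _ _).mono hmU
  have d2 : DeterminedBy H U := (determinedBy_crossing _ _ _).mono hRU
  have d3 : DeterminedBy V U := (determinedBy_crossing _ _ _).mono hSU
  have u1 : IsUpperSet (hcross m (2 * a)) := isUpperSet_crossing _ _ _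
  have hfin : U.Finite := finite_box _ _ _ _
  have i1 := harris hfin d1 d2 u1 (isUpperSet_crossing _ _ _)
  have i2 := harris hfin (d1.inter d2) d3 (u1.inter (isUpperSet_crossing _ _ _))
    (isUpperSet_crossing _ _ _)
  have hfinal : hcross m (2 * a) ∩ H ∩ V ⊆ hcross (m + a) (2 * a) := by
    rintro ξ ⟨⟨⟨p, hp, q, hq, l₁⟩, p', hp', q', hq', l₂⟩, s, hs, t, ht, l₃⟩
    simp only [Set.mem_ofPred_eq] at hp hq hp' hq' hs ht
    have k₁ := crossings_linked hp hq hs ht (fun z hz => hz.2)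
      (fun z hz => ⟨by have := hz.1.1; omega, hz.1.2⟩) hmU hSU l₁ l₃
    have k₂ := crossings_linked hp' hq' hs ht (fun z hz => hz.2)
      (fun z hz => ⟨hz.1.1, by have := hz.1.2; omega⟩) hRU hSU l₂ l₃
    exact ⟨p, hp, q', hq', (k₁.trans k₂.symm).trans
      (l₂.mono (Set.inter_subset_inter_right _ hRU))⟩
  have j1 := mul_le_mul_of_nonneg_left e1
    (measureReal_nonneg (μ := cellMeasure) (s := hcross m (2 * a)))
  have j2 := mul_le_mul_of_nonneg_left e2
    (measureReal_nonneg (μ := cellMeasure) (s := hcross m (2 * a) ∩ H))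
  have j3 : cellMeasure.real (hcross m (2 * a) ∩ H ∩ V) ≤ _ := measureReal_mono hfinal
  linarith

theorem le_hcross_long {a : ℤ} (ha : 1 ≤ a) (k : ℕ) :
    (1 / 256 : ℝ) ^ (k + 1) ≤ cellMeasure.real (hcross (3 * a + k * a) (2 * a)) := by
  induction k with
  | zero =>
    have := hcross_three_two ha
    simp only [Nat.cast_zero, zero_mul, add_zero]
    linarith
  | succ k ih =>
    have h1 : 0 ≤ (k : ℤ) * a := by positivity
    have := hcross_glue ha (m := 3 * a + k * a) (by omega)
    rw [show (3 * a + ((k + 1 : ℕ) : ℤ) * a) = 3 * a + k * a + a by push_cast; ring, pow_succ]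
    linarith

/-- It is enough that the `m` edges of the bottom row are open. This covers heights 0 and 1, too low
for the gluing argument. -/
theorem le_hcross_of_nonneg (m : ℕ) {n : ℤ} (hn : 0 ≤ n) :
    (1 / 2 : ℝ) ^ m ≤ cellMeasure.real (hcross m n) := by
  have hinj : Function.Injective fun i : ℕ => ((2 * i + 1, 0) : ℤ × ℤ) := by
    intro i j h
    simp only [Prod.mk.injEq] at h
    omega
  set s : Finset (ℤ × ℤ) := (Finset.range m).map ⟨_, hinj⟩ with hs
  have h1 : cellMeasure.real (Set.pi s fun _ => {true}) = (1 / 2 : ℝ) ^ m := by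
    rw [Measure.real, cellMeasure, Measure.infinitePi_pi _ fun _ _ => measurableSet_singleton _]
    simp [hs, half]
  rw [← h1]
  refine measureReal_mono fun ξ hξ => ?_
  have hb : ∀ x : ℤ, 0 ≤ x → x ≤ 2 * m → (x, 0) ∈ black ξ ∩ box 0 (2 * m) 0 (2 * n) := by
    intro x h0 hx
    refine ⟨?_, ⟨h0, hx⟩, le_rfl, by simp only; omega⟩
    by_cases hpar : x % 2 = 0
    · exact mem_black_of_even hpar rfl
    · refine (mem_black_of_mixed (by simp only; omega)).2 (hξ _ ?_)
      simp only [hs, Finset.coe_map, Function.Embedding.coeFn_mk, Set.mem_image, Finset.coe_range,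
        Set.mem_Iio]
      exact ⟨(x / 2).toNat, by omega, Prod.ext (by simp only; omega) rfl⟩
  have key : ∀ x : ℕ, (x : ℤ) ≤ 2 * m →
      Linked (black ξ ∩ box 0 (2 * m) 0 (2 * n)) (0, 0) ((x : ℤ), 0) := by
    intro x
    induction x with
    | zero => intro _; exact Linked.refl (hb 0 le_rfl (by omega))
    | succ x ih =>
      intro hx
      exact (ih (by omega)).step (hb x (by omega) (by omega))
        (squareLattice_adj_iff.2 (Or.inl ⟨by push_cast; rfl, rfl⟩)) (hb _ (by omega) hx)
  exact ⟨_, rfl, _, by simp, key (2 * m) (by omega)⟩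

/-- Crossing probabilities of rectangles of bounded aspect ratio are bounded below. -/
theorem exists_le_hcross (K : ℕ) : ∃ c : ℝ, 0 < c ∧ ∀ m n : ℤ, 0 ≤ m → 0 ≤ n →
    m ≤ K * (n + 1) → c ≤ cellMeasure.real (hcross m n) := by
  refine ⟨min ((1 / 2) ^ (2 * K)) ((1 / 256) ^ (4 * K + 1)), by positivity, ?_⟩
  intro m n hm hn hmn
  by_cases hn1 : n ≤ 1
  · lift m to ℕ using hm
    refine (min_le_left _ _).trans (le_trans ?_ (le_hcross_of_nonneg m hn))
    refine pow_le_pow_of_le_one (by norm_num) (by norm_num) ?_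
    have : (m : ℤ) ≤ K * 2 := hmn.trans (mul_le_mul_of_nonneg_left (by omega) (by positivity))
    omega
  -- With a = ⌊n/2⌋ ≥ 1 one has 2a ≤ n and n + 1 ≤ 4a, so the rectangle is no longer than 4Ka and at
  -- least as high as 2a.
  · refine (min_le_right _ _).trans ((le_hcross_long (a := n / 2) (by omega) (4 * K)).trans ?_)
    refine measureReal_mono ((hcross_anti hm ?_).trans (hcross_mono (by omega)))
    have : (K : ℤ) * (n + 1) ≤ K * (4 * (n / 2)) :=
      mul_le_mul_of_nonneg_left (by omega) (by positivity)
    push_cast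
    have h2 : (K : ℤ) * (4 * (n / 2)) = 4 * K * (n / 2) := by ring
    omega

/-! ### Transfer to bond percolation -/

/-- The cell of the doubled lattice that stands for an edge of the square lattice. -/
def edgeCell (e : squareLattice.edgeSet) : ℤ × ℤ :=
  Sym2.lift ⟨fun x y => (x.1 + y.1, x.2 + y.2), fun x y =>
    Prod.ext (add_comm x.1 y.1) (add_comm x.2 y.2)⟩ e.1

theorem edgeCell_mk {x y : ℤ × ℤ} (h : s(x, y) ∈ squareLattice.edgeSet) :
    edgeCell ⟨s(x, y), h⟩ = (x.1 + y.1, x.2 + y.2) := rfl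

theorem edgeCell_injective : Function.Injective edgeCell := by
  rintro ⟨e, he⟩ ⟨e', he'⟩ h
  induction e using Sym2.ind with | _ x y
  induction e' using Sym2.ind with | _ x' y'
  rw [edgeCell_mk, edgeCell_mk, Prod.mk.injEq] at h
  rw [SimpleGraph.mem_edgeSet, squareLattice_adj_iff] at he he'
  refine Subtype.ext ?_
  simp only [Sym2.eq_iff, Prod.ext_iff]
  omega

/-- Distinct edges have distinct midpoints, so reading the independent colours at the midpoints
gives independent edges. -/
theorem bondMeasure_half_eq : bondMeasure half = cellMeasure.map fun ξ e => ξ (edgeCell e) :=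
  (Measure.map_infinitePi_infinitePi_of_inj
    (P := fun _ : ℤ × ℤ => ProbabilityTheory.bernoulliMeasure true false half)
    edgeCell_injective).symm

/-- The vertex `y` of the square lattice as a cell of the doubled lattice. -/
def vertexCell (y : ℤ × ℤ) : ℤ × ℤ := (2 * y.1, 2 * y.2)

theorem vertexCell_mem {m n : ℤ} {ξ : ℤ × ℤ → Bool} {y : ℤ × ℤ} :
    vertexCell y ∈ black ξ ∩ box 0 (2 * m) 0 (2 * n) ↔ y ∈ rect m n := by
  have h : vertexCell y ∈ black ξ :=
    mem_black_of_even (by simp only [vertexCell]; omega) (by simp only [vertexCell]; omega)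
  simp only [Set.mem_inter_iff, h, true_and]
  simp only [vertexCell, box, rect, Set.mem_ofPred_eq, Set.mem_prod, Set.mem_Icc]
  omega

theorem linked_of_walk {m n : ℤ} {ξ : ℤ × ℤ → Bool} {x y : ℤ × ℤ}
    (γ : (openGraph fun e => ξ (edgeCell e)).Walk x y) (h : ∀ v ∈ γ.support, v ∈ rect m n) :
    Linked (black ξ ∩ box 0 (2 * m) 0 (2 * n)) (vertexCell x) (vertexCell y) := by
  induction γ with
  | nil => exact Linked.refl (vertexCell_mem.2 (h _ (by simp)))
  | @cons x x' y ha γ ih =>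
    have hx : x ∈ rect m n := h x (by simp)
    have hx' : x' ∈ rect m n := h x' (by simp)
    refine Linked.trans ?_ (ih fun v hv => h v (by simp [hv]))
    obtain ⟨hadj, hopen⟩ := ha
    replace hopen : ξ (x.1 + x'.1, x.2 + x'.2) = true := hopen
    have hadj' := squareLattice_adj_iff.1 hadj
    have hmem : (x.1 + x'.1, x.2 + x'.2) ∈ black ξ ∩ box 0 (2 * m) 0 (2 * n) := by
      refine ⟨(mem_black_of_mixed (by simp only; omega)).2 hopen, ?_⟩
      simp only [rect, Set.mem_prod, Set.mem_Icc] at hx hx'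
      simp only [box, Set.mem_ofPred_eq]
      omega
    refine (Linked.of_adj (vertexCell_mem.2 hx) ?_ hmem).step hmem ?_ (vertexCell_mem.2 hx')
    · rw [squareLattice_adj_iff]; simp only [vertexCell]; omega
    · rw [squareLattice_adj_iff]; simp only [vertexCell]; omega

theorem walk_of_linked {m n : ℤ} {ξ : ℤ × ℤ → Bool} {x y : ℤ × ℤ}
    (h : Linked (black ξ ∩ box 0 (2 * m) 0 (2 * n)) (vertexCell x) (vertexCell y)) :
    ∃ γ : (openGraph fun e => ξ (edgeCell e)).Walk x y, ∀ v ∈ γ.support, v ∈ rect m n := by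
  have hx : x ∈ rect m n := vertexCell_mem.1 h.1
  let Reach : ℤ × ℤ → Prop := fun y =>
    ∃ γ : (openGraph fun e => ξ (edgeCell e)).Walk x y, ∀ v ∈ γ.support, v ∈ rect m n
  -- The induction passes through edge cells, so the invariant has a second clause: at an edge cell,
  -- one of its endpoints has been reached. The next vertex is then that endpoint or the other end
  -- of an open edge.
  suffices key : (∀ y', vertexCell y = vertexCell y' → Reach y') ∧
      (((vertexCell y).1 + (vertexCell y).2) % 2 = 1 →
        ∃ y', squareLattice.Adj (vertexCell y') (vertexCell y) ∧ Reach y') from key.1 y rfl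
  refine h.induction (motive := fun z => (∀ y', z = vertexCell y' → Reach y') ∧
    ((z.1 + z.2) % 2 = 1 → ∃ y', squareLattice.Adj (vertexCell y') z ∧ Reach y')) ?_ ?_
  · constructor
    · intro y' hy'
      obtain rfl : x = y' := by
        simp only [vertexCell, Prod.mk.injEq] at hy'
        exact Prod.ext (by omega) (by omega)
      exact ⟨SimpleGraph.Walk.nil, by simpa using hx⟩
    · intro hm
      simp only [vertexCell] at hm
      omega
  · rintro u v hu hv ha - ⟨ih1, ih2⟩
    constructor
    · rintro y' rfl
      have ha' := squareLattice_adj_iff.1 ha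
      obtain ⟨z, hz, γ, hγ⟩ := ih2 (by simp only [vertexCell] at ha'; omega)
      have hz' := squareLattice_adj_iff.1 hz
      by_cases hzy : z = y'
      · subst hzy; exact ⟨γ, hγ⟩
      · have hne : z.1 ≠ y'.1 ∨ z.2 ≠ y'.2 := by
          by_contra hcon
          push Not at hcon
          exact hzy (Prod.ext hcon.1 hcon.2)
        simp only [vertexCell] at ha' hz'
        have hadj : squareLattice.Adj z y' := by rw [squareLattice_adj_iff]; omega
        have hu' : u = (z.1 + y'.1, z.2 + y'.2) := Prod.ext (by simp only; omega) (by simp only; omega)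
        have hopen : (openGraph fun e => ξ (edgeCell e)).Adj z y' := by
          refine ⟨hadj, ?_⟩
          change ξ (z.1 + y'.1, z.2 + y'.2) = true
          rw [← hu']
          exact (mem_black_of_mixed (by omega)).1 hu.1
        refine ⟨γ.concat hopen, fun w hw => ?_⟩
        rw [SimpleGraph.Walk.support_concat, List.mem_append, List.mem_singleton] at hw
        rcases hw with hw | rfl
        exacts [hγ w hw, vertexCell_mem.1 hv]
    · intro hm
      have ha' := squareLattice_adj_iff.1 ha
      rcases hu.1 with hu' | hu'
      · have huc : u = vertexCell (u.1 / 2, u.2 / 2) :=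
          Prod.ext (by simp only [vertexCell]; omega) (by simp only [vertexCell]; omega)
        exact ⟨_, huc ▸ ha, ih1 _ huc⟩
      · omega

/-- A crossing by cells may begin or end at an edge lying along the side of the rectangle; it is
then extended to the lower endpoint of that edge. -/
theorem exists_vertexCell_linked {m n : ℤ} {ξ : ℤ × ℤ → Bool} {p : ℤ × ℤ}
    (hp : p ∈ black ξ ∩ box 0 (2 * m) 0 (2 * n)) (h : p.1 % 2 = 0) :
    ∃ y : ℤ × ℤ, 2 * y.1 = p.1 ∧
      Linked (black ξ ∩ box 0 (2 * m) 0 (2 * n)) (vertexCell y) p := by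
  obtain ⟨hb, hbox⟩ := hp
  have hbox' := hbox
  simp only [box, Set.mem_ofPred_eq] at hbox'
  refine ⟨(p.1 / 2, p.2 / 2), by simp only; omega, ?_⟩
  by_cases h2 : p.2 % 2 = 0
  · have : vertexCell (p.1 / 2, p.2 / 2) = p :=
      Prod.ext (by simp only [vertexCell]; omega) (by simp only [vertexCell]; omega)
    rw [this]
    exact Linked.refl ⟨hb, hbox⟩
  · refine Linked.of_adj (vertexCell_mem.2 ?_) ?_ ⟨hb, hbox⟩
    · simp only [rect, Set.mem_prod, Set.mem_Icc]; omega
    · rw [squareLattice_adj_iff]; simp only [vertexCell]; omega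

theorem mem_horizontalCrossing_iff {m n : ℤ} {ξ : ℤ × ℤ → Bool} :
    (fun e => ξ (edgeCell e)) ∈ horizontalCrossing m n ↔ ξ ∈ hcross m n := by
  constructor
  · rintro ⟨x, hx, y, hy, γ, -, hγ⟩
    refine ⟨vertexCell x, ?_, vertexCell y, ?_, linked_of_walk γ hγ⟩
    · have := hx.1
      simp only [Set.mem_singleton_iff] at this
      simp [vertexCell, this]
    · have := hy.1
      simp only [Set.mem_singleton_iff] at this
      simp [vertexCell, this]
  · classical
    rintro ⟨p, hp, q, hq, hl⟩
    simp only [Set.mem_ofPred_eq] at hp hq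
    obtain ⟨x, hx, hxp⟩ := exists_vertexCell_linked hl.1 (by omega)
    obtain ⟨y, hy, hyq⟩ := exists_vertexCell_linked hl.right_mem (by omega)
    obtain ⟨γ, hγ⟩ := walk_of_linked ((hxp.trans hl).trans hyq.symm)
    have hxr : x ∈ rect m n := hγ x γ.start_mem_support
    have hyr : y ∈ rect m n := hγ y γ.end_mem_support
    exact ⟨x, ⟨by simp only [Set.mem_singleton_iff]; omega, hxr.2⟩, y,
      ⟨by simp only [Set.mem_singleton_iff]; omega, hyr.2⟩, γ.bypass, γ.bypass_isPath,
      fun v hv => hγ v (γ.support_bypass_subset_support hv)⟩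

/-- Reflection in the diagonal acts on the walks of open edges. -/
theorem mem_verticalCrossing_of_hcross {m n : ℤ} {ξ : ℤ × ℤ → Bool}
    (h : (fun k => ξ k.swap) ∈ hcross m n) :
    (fun e => ξ (edgeCell e)) ∈ verticalCrossing n m := by
  classical
  obtain ⟨x, hx, y, hy, γ, -, hγ⟩ := mem_horizontalCrossing_iff.2 h
  let φ : (openGraph fun e => ξ (edgeCell e).swap) →g (openGraph fun e => ξ (edgeCell e)) :=
    ⟨Prod.swap, by
      rintro a b ⟨hab, hopen⟩
      have : squareLattice.Adj a.swap b.swap := by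
        rw [squareLattice_adj_iff] at hab ⊢
        simp only [Prod.fst_swap, Prod.snd_swap]
        omega
      exact ⟨this, hopen⟩⟩
  refine ⟨x.swap, ⟨hx.2, hx.1⟩, y.swap, ⟨hy.2, hy.1⟩, (γ.map φ).bypass,
    SimpleGraph.Walk.bypass_isPath _, fun v hv => ?_⟩
  have hv' := SimpleGraph.Walk.support_bypass_subset_support _ hv
  rw [SimpleGraph.Walk.support_map, List.mem_map] at hv'
  obtain ⟨w, hw, rfl⟩ := hv'
  exact ⟨(hγ w hw).2, (hγ w hw).1⟩

open Classical in
/-- The colouring of the doubled lattice given by a percolation configuration. -/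
noncomputable def cellsOf (ω : Config) : ℤ × ℤ → Bool :=
  fun p => if h : ∃ e, edgeCell e = p then ω h.choose else false

theorem cellsOf_edgeCell (ω : Config) : (fun e => cellsOf ω (edgeCell e)) = ω := by
  funext e
  have h : ∃ e', edgeCell e' = edgeCell e := ⟨e, rfl⟩
  rw [cellsOf, dif_pos h, edgeCell_injective h.choose_spec]

theorem measurable_cellsOf : Measurable cellsOf := by
  refine measurable_pi_lambda _ fun p => ?_
  by_cases h : ∃ e, edgeCell e = p
  · simp only [cellsOf, dif_pos h]
    exact measurable_pi_apply _
  · simp only [cellsOf, dif_neg h]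
    exact measurable_const

theorem bondMeasure_horizontalCrossing (m n : ℤ) :
    (bondMeasure half).real (horizontalCrossing m n) = cellMeasure.real (hcross m n) := by
  -- Needed for measurability, which comes from the finite determination of `hcross m n`.
  have h1 : horizontalCrossing m n = cellsOf ⁻¹' hcross m n := by
    ext ω
    rw [Set.mem_preimage, ← mem_horizontalCrossing_iff, cellsOf_edgeCell]
  have h2 : MeasurableSet (hcross m n) :=
    (determinedBy_crossing _ _ _).measurableSet (finite_box _ _ _ _)
  have h3 : MeasurableSet (horizontalCrossing m n) := h1 ▸ measurable_cellsOf h2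
  rw [bondMeasure_half_eq, Measure.real, Measure.real, Measure.map_apply (by fun_prop) h3]
  congr 2
  ext ξ
  exact mem_horizontalCrossing_iff

theorem hcross_le_bondMeasure_verticalCrossing (m n : ℤ) :
    cellMeasure.real (hcross m n) ≤ (bondMeasure half).real (verticalCrossing n m) := by
  have hdet := determinedBy_crossing (box 0 (2 * m) 0 (2 * n)) {z | z.1 = 0} {z | z.1 = 2 * m}
  have hm : Measurable fun (ξ : ℤ × ℤ → Bool) e => ξ (edgeCell e) := by fun_prop
  have : IsProbabilityMeasure (bondMeasure half) := by unfold bondMeasure; infer_instance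
  refine (measure_le_of_comp (E' := (fun ξ e => ξ (edgeCell e)) ⁻¹' verticalCrossing n m)
    (finite_box _ _ _ _) hdet Prod.swap_injective
    fun ξ h => mem_verticalCrossing_of_hcross h).trans ?_
  refine ENNReal.toReal_mono (measure_ne_top _ _) ?_
  rw [bondMeasure_half_eq]
  -- This inequality holds for arbitrary sets, so measurability of the vertical crossing event is
  -- not needed.
  exact Measure.le_map_apply hm.aemeasurable _

end Percolation

/-! ### The box-crossing property -/

theorem mainTheorem6 :
    (∀ ρ : ℝ, 0 < ρ → ∃ c : ℝ, 0 < c ∧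
      ∀ n m : ℤ, 1 ≤ n → 1 ≤ m → |(m : ℝ) - ρ * n| < 1 →
        c ≤ (Percolation.bondMeasure Percolation.half).real (Percolation.horizontalCrossing m n) ∧
        (Percolation.bondMeasure Percolation.half).real (Percolation.horizontalCrossing m n)
          ≤ 1 - c) ∧
    ∀ n : ℤ, 1 ≤ n →
      1 / 128 ≤ (Percolation.bondMeasure Percolation.half).real
        (Percolation.verticalCrossing (2 * n) (3 * n)) := by
  refine ⟨fun ρ hρ => ?_, fun n hn => (Percolation.hcross_three_two hn).trans
    (Percolation.hcross_le_bondMeasure_verticalCrossing _ _)⟩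
  -- From m < ρn + 1 follows m ≤ (ρ + 1)n, and from ρn < m + 1 ≤ 2m follows n + 1 ≤ (2/ρ + 1)m. So
  -- one `K` serves both the rectangle and its dual.
  obtain ⟨K, hK⟩ := exists_nat_ge (max (ρ + 1) (2 / ρ + 1))
  obtain ⟨c, hc, h⟩ := Percolation.exists_le_hcross K
  refine ⟨c, hc, fun n m hn hm hmn => ?_⟩
  rw [Percolation.bondMeasure_horizontalCrossing]
  rw [abs_lt] at hmn
  have hn' : (1 : ℝ) ≤ n := by exact_mod_cast hn
  have hm' : (1 : ℝ) ≤ m := by exact_mod_cast hm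
  have hK1 := (le_max_left _ _).trans hK
  have hK2 := (le_max_right _ _).trans hK
  have h1 := h m n (by omega) (by omega) (by
    have : (m : ℝ) ≤ K * (n + 1) := by nlinarith
    exact_mod_cast this)
  -- The dual rectangle has height m - 1, possibly 0, which is why `exists_le_hcross` allows height
  -- 0 and bounds the length by K times the height plus one.
  have h2 := h (n + 1) (m - 1) (by omega) (by omega) (by
    have h3 : (n : ℝ) ≤ 2 / ρ * m := by
      rw [div_mul_eq_mul_div, le_div_iff₀ hρ]
      linarith
    have : ((n + 1 : ℤ) : ℝ) ≤ K * ((m - 1 : ℤ) + 1) := by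
      push_cast
      nlinarith
    exact_mod_cast this)
  have h3 := Percolation.hcross_add_hcross_le (m := m) (n := n)
  exact ⟨h1, by linarith⟩
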